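/- **Lemma (Duality).** Let $C\subset\mathbb{R}^2$ be a finite set of points, $V(p)=\{q\in\mathbb R^2: |p-q|\le|p'-q|\ \forall p'\in C\}$ the Voronoi cell of $p\in C$, and let $\mathrm{Del}(C)$ be a Delaunay triangulation of $C$: a geometric simplicial complex with vertex set $C$ whose union is the convex hull of $C$ and each of whose simplices $\sigma$ satisfies $\bigcap_{p\in\sigma}V(p)\neq\emptyset$. (It is the nerve of the Voronoi diagram if no empty circle passes through four points of $C$.) For $\alpha\ge 0$ the *$\alpha$-complex* $C(\alpha)$ consists of the simplices $\sigma$ of $\mathrm{Del}(C)$ with $\bigcap_{p\in\sigma}(V(p)\cap B(p;\alpha))\ne\emptyset$, where $B(p;\alpha)$ is the closed disk. A *hole* of $C(\alpha)$ is a bounded connected component $R$ of $\mathbb R^2-|C(\alpha)|$, and a *contour* of $C(\alpha)$ is a nonzero cycle of edges of $C(\alpha)$ (with coefficients in $\mathbb Z/2$) that bounds a hole: $\gamma=\partial R$ is the set of edges of $\mathrm{Del}(C)$ that have $R$ on exactly one side. The graph $C^*$ dual to $\mathrm{Del}(C)$ has one vertex for every triangle and a vertex $v_0$ for the external region; two vertices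 are joined by an edge if the corresponding triangles (or external region) have a common side, and the length of this edge is the length of the longest common side. The graph $C^*(\alpha)$ is obtained from $C^*$ by keeping only the edges of length $>2\alpha$ and removing every vertex $v\ne v_0$ that is then isolated, unless its triangle is acute and has circumradius $>\alpha$. The connected components of $C^*(\alpha)$ not containing $v_0$ are called *white*. For $\beta\le\alpha$, a contour $\gamma=\partial R$ of $C(\alpha)$ *evolves into* a contour $\gamma'=\partial R'$ of $C(\beta)$ if $R\subset R'$, and a white component of $C^*(\alpha)$ evolves into the white component of $C^*(\beta)$ that contains it. A contour or white component that evolves into nothing at scale $\beta$ has been absorbed by the external region. The *birth* of a contour (white component) $x$ is the supremum of the scales at which some contour (white component) evolving into $x$ is present. Two of them, present at the same scale $\alpha$, *merge* at the supremum of the scales $r\le\alpha$ at which they have evolved into the same one or have both been absorbed. *Deaths* are given by the elder rule: among the contours (white components) at scale $\alpha$ that evolve into the same one $y$ at scale $\beta$, one with the largest birth survives as $y$ and the others die (ties being broken by any fixed consistent choice); those absorbed by the external region die; the death of $x$ is the infimum of the scales at which $x$ survives. Then there are bijections $\Phi_\alpha$, $\alpha\ge0$, from the set of contours of $C(\alpha)$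 onto the set of connected components of $C^*(\alpha)$ not containing $v_0$, such that 1. if the contour $\gamma$ of $C(\alpha)$ bounds the hole $R$, then the open triangles represented by the vertices of $\Phi_\alpha(\gamma)$ lie in $R$; 2. for $\beta\le\alpha$, a contour $\gamma$ of $C(\alpha)$ evolves into a contour $\gamma'$ of $C(\beta)$ if and only if $\Phi_\alpha(\gamma)$ evolves into $\Phi_\beta(\gamma')$; 3. as $\alpha$ decreases, births of contours correspond to births of white components: $\gamma$ and $\Phi_\alpha(\gamma)$ have the same birth; 4. mergers correspond: two contours of $C(\alpha)$ merge at the same scale as the corresponding white components; 5. deaths of contours correspond to deaths of white components: under $\Phi$, the choices of survivors that obey the elder rule are the same for contours and for white components, and for each such choice $\gamma$ and $\Phi_\alpha(\gamma)$ have the same death. -/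

import Mathlib

open scoped NNReal

noncomputable section

namespace AlphaDuality

/-- The Euclidean plane. -/
abbrev Plane : Type := EuclideanSpace ℝ (Fin 2)

/-! ### Voronoi cells, Delaunay triangulations, alpha-complexes -/

/-- The (closed) Voronoi cell of `p` with respect to the cloud `C`. -/
def voronoiCell (C : Finset Plane) (p : Plane) : Set Plane :=
  {q | ∀ p' ∈ C, dist p q ≤ dist p' q}

/-- `K` is a Delaunay triangulation of the cloud `C`: a geometric simplicial complex with vertex
set `C` that triangulates the convex hull of `C` and all of whose simplices belong to the nerve of
the Voronoi diagram. If no empty circle passes through four points of `C`, the nerve itself is the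
only such complex; otherwise a Delaunay triangulation involves a choice. -/
structure IsDelaunay (C : Finset Plane) (K : Geometry.SimplicialComplex ℝ Plane) : Prop where
  vertices_eq : K.vertices = (C : Set Plane)
  space_eq : K.space = convexHull ℝ (C : Set Plane)
  nerve : ∀ σ ∈ K.faces, (⋂ p ∈ σ, voronoiCell C p).Nonempty

/-- The alpha-complex `C(α)`: the simplices of the Delaunay triangulation `K` that belong to the
nerve of the sets `V(p) ∩ B(p; α)`. -/
def alphaComplex (C : Finset Plane) (K : Geometry.SimplicialComplex ℝ Plane) (α : ℝ≥0) :
    Geometry.SimplicialComplex ℝ Plane where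
  faces := {σ | σ ∈ K.faces ∧
    (⋂ p ∈ σ, (voronoiCell C p ∩ Metric.closedBall p (α : ℝ))).Nonempty}
  isRelLowerSet_faces := by
    intro σ hσ
    refine ⟨K.nonempty_of_mem_faces hσ.1, fun τ hτ hne => ⟨K.down_closed hσ.1 hτ hne, ?_⟩⟩
    exact hσ.2.mono (Set.biInter_subset_biInter_left hτ)
  indep hσ := K.indep hσ.1
  inter_subset_convexHull hσ hτ := K.inter_subset_convexHull hσ.1 hτ.1

/-- The open triangle with vertex set `t`. -/
def openTriangle (t : Finset Plane) : Set Plane :=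
  interior (convexHull ℝ (t : Set Plane))

/-! ### Contours -/

/-- A hole of a planar complex `S`: a bounded connected component of the complement of `|S|`. -/
def IsHole (S : Geometry.SimplicialComplex ℝ Plane) (R : Set Plane) : Prop :=
  (∃ x ∈ S.spaceᶜ, R = connectedComponentIn S.spaceᶜ x) ∧ Bornology.IsBounded R

/-- A finite set `γ` of edges of `S` is a (nonzero) cycle with coefficients in `ℤ/2ℤ`: every
point is an endpoint of an even number of edges of `γ`. -/
def IsCycle (S : Geometry.SimplicialComplex ℝ Plane) (γ : Finset (Finset Plane)) : Prop :=
  γ.Nonempty ∧ (∀ e ∈ γ, e ∈ S.faces ∧ e.card = 2) ∧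
    ∀ p : Plane, Even {e | e ∈ γ ∧ p ∈ e}.ncard

/-- `γ = ∂R` for a bounded region `R`: the edges in `γ` are exactly those edges of the
triangulation `K` that have `R` on exactly one side. -/
def Bounds (K : Geometry.SimplicialComplex ℝ Plane) (γ : Finset (Finset Plane))
    (R : Set Plane) : Prop :=
  ∀ e : Finset Plane, e ∈ γ ↔ (e ∈ K.faces ∧ e.card = 2 ∧
    ∃! t : Finset Plane, t ∈ K.faces ∧ t.card = 3 ∧ e ⊆ t ∧ openTriangle t ⊆ R)

/-- The contours of `C(α)`: the cycles in `C(α)` that bound a hole of `C(α)`. -/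
def Contour (C : Finset Plane) (K : Geometry.SimplicialComplex ℝ Plane) (α : ℝ≥0) : Type :=
  {γ : Finset (Finset Plane) // IsCycle (alphaComplex C K α) γ ∧
    ∃ R, IsHole (alphaComplex C K α) R ∧ Bounds K γ R}

/-- A contour `γ` of `C(α)` evolves into a contour `γ'` of `C(β)` (where `β ≤ α`) if the hole
bounded by `γ` lies in the hole bounded by `γ'`. -/
def Contour.EvolvesTo (C : Finset Plane) (K : Geometry.SimplicialComplex ℝ Plane) (α β : ℝ≥0)
    (γ : Contour C K α) (γ' : Contour C K β) : Prop :=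
  ∃ R R', IsHole (alphaComplex C K α) R ∧ Bounds K γ.1 R ∧
    IsHole (alphaComplex C K β) R' ∧ Bounds K γ'.1 R' ∧ R ⊆ R'

/-! ### The dual graphs -/

/-- The nodes of the dual graph: `some t` for every triangle `t` of the triangulation, and
`none` for the external region (the vertex `v₀`). -/
abbrev Node (K : Geometry.SimplicialComplex ℝ Plane) : Type :=
  Option {t : Finset Plane // t ∈ K.faces ∧ t.card = 3}

/-- The edge `e` is a side of the triangle, or of the external region, represented by a node.
The sides of the external region are the edges that lie in exactly one triangle. -/
def IsSide (K : Geometry.SimplicialComplex ℝ Plane) (e : Finset Plane) : Node K → Prop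
  | some t => e.card = 2 ∧ e ⊆ t.1
  | none => e.card = 2 ∧ ∃! t : Finset Plane, t ∈ K.faces ∧ t.card = 3 ∧ e ⊆ t

/-- The lengths of the common edges of two (generalized) triangles. -/
def commonLengths (K : Geometry.SimplicialComplex ℝ Plane) (v w : Node K) : Set ℝ :=
  {d | ∃ e, IsSide K e v ∧ IsSide K e w ∧ d = Metric.diam (e : Set Plane)}

/-- The graph `C*` dual to the triangulation. -/
def dualGraph (K : Geometry.SimplicialComplex ℝ Plane) : SimpleGraph (Node K) where
  Adj v w := v ≠ w ∧ (commonLengths K v w).Nonempty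
  symm := ⟨by
    rintro v w ⟨h, d, e, h1, h2, h3⟩
    exact ⟨h.symm, d, e, h2, h1, h3⟩⟩
  loopless := ⟨fun _ h => h.1 rfl⟩

/-- The edge of `C*` joining `v` and `w` exists and has length `> 2α`, its length being that of
the longest common edge of the two triangles. -/
def LongAdj (K : Geometry.SimplicialComplex ℝ Plane) (α : ℝ≥0) (v w : Node K) : Prop :=
  (dualGraph K).Adj v w ∧ ∃ d, IsGreatest (commonLengths K v w) d ∧ 2 * (α : ℝ) < d

/-- The node represents an acute triangle with circumradius `> α`. -/
def AcuteLarge (K : Geometry.SimplicialComplex ℝ Plane) (α : ℝ≥0) (v : Node K) : Prop :=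
  ∃ t, v = some t ∧ ∃ s : Affine.Triangle ℝ Plane,
    Set.range s.points = (t.1 : Set Plane) ∧ s.AcuteAngled ∧ (α : ℝ) < s.circumradius

/-- The graph `C*(α)`: only the edges of `C*` of length `> 2α` are kept, and an isolated node
other than `v₀` is removed unless its triangle is acute with circumradius `> α`. -/
def alphaGraph (K : Geometry.SimplicialComplex ℝ Plane) (α : ℝ≥0) : (dualGraph K).Subgraph where
  verts := {v | v = none ∨ (∃ w, LongAdj K α v w) ∨ AcuteLarge K α v}
  Adj := LongAdj K α
  adj_sub h := h.1
  edge_vert h := Or.inr (Or.inl ⟨_, h⟩)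
  symm := ⟨by
    rintro v w ⟨h, d, hd, hα⟩
    refine ⟨h.symm, d, ?_, hα⟩
    have : commonLengths K w v = commonLengths K v w := by
      ext x
      simp only [commonLengths, Set.mem_ofPred_eq]
      exact ⟨fun ⟨e, h1, h2, h3⟩ => ⟨e, h2, h1, h3⟩, fun ⟨e, h1, h2, h3⟩ => ⟨e, h2, h1, h3⟩⟩
    rwa [this]⟩

/-- The white components: the connected components of `C*(α)` not containing `v₀`. -/
def WhiteComponent (K : Geometry.SimplicialComplex ℝ Plane) (α : ℝ≥0) : Type :=
  {c : (alphaGraph K α).coe.ConnectedComponent //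
    (⟨none, Or.inl rfl⟩ : (alphaGraph K α).verts) ∉ c.supp}

/-- The nodes of a white component. -/
def WhiteComponent.nodes {K : Geometry.SimplicialComplex ℝ Plane} {α : ℝ≥0}
    (c : WhiteComponent K α) : Set (Node K) :=
  Subtype.val '' c.1.supp

/-- A white component `c` of `C*(α)` evolves into a white component `c'` of `C*(β)` (where
`β ≤ α`) if it is contained in it. -/
def WhiteComponent.EvolvesTo (K : Geometry.SimplicialComplex ℝ Plane) (α β : ℝ≥0)
    (c : WhiteComponent K α) (c' : WhiteComponent K β) : Prop :=
  c.nodes ⊆ c'.nodes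

/-! ### Births and deaths as the scale decreases

`X α` is the set of features (contours or white components) present at scale `α`, and `ev α β x y`
says that the feature `x` at scale `α` has become (a part of) the feature `y` at a smaller scale `β`. A feature with
no `y` at the smaller scale has been absorbed by the external region. -/

section Evolution

variable (X : ℝ≥0 → Type) (ev : ∀ α β : ℝ≥0, X α → X β → Prop)

/-- `s` is the birth scale of `x`: the supremum of the scales at which some feature that evolves
into `x` is present. -/
def BornAt {α : ℝ≥0} (x : X α) (s : ℝ≥0) : Prop :=
  IsLUB {r : ℝ≥0 | α ≤ r ∧ ∃ x' : X r, ev r α x' x} s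

/-- At scale `r` the feature `x` has been absorbed by the external region. -/
def Absorbed {α : ℝ≥0} (x : X α) (r : ℝ≥0) : Prop :=
  ¬ ∃ y : X r, ev α r x y

/-- `t` is the scale at which `x` and `x'` merge: the first moment, as the scale decreases, at
which they are parts of one and the same feature, or both part of the external region. -/
def MergeAt {α : ℝ≥0} (x x' : X α) (t : ℝ≥0) : Prop :=
  IsLUB {r : ℝ≥0 | r ≤ α ∧ ((∃ y : X r, ev α r x y ∧ ev α r x' y) ∨
    (Absorbed X ev x r ∧ Absorbed X ev x' r))} t

/-- The elder rule. A labelling `lab` records which features at different scales are regarded as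
the same one: among the features at scale `α` that have become parts of `y`, one of the oldest
survives as `y` and keeps its label, and the others die. The external region is older than
everything, so a feature absorbed by it dies. If several of the features are the oldest, any one of
them may be chosen as the survivor, so there may be several such labellings. -/
structure IsElderLabelling {L : Type} (lab : ∀ α : ℝ≥0, X α → L) : Prop where
  /-- different features present at one scale have different labels -/
  injective : ∀ α, Function.Injective (lab α)
  /-- the survivor is one of the oldest features -/
  elder : ∀ α β : ℝ≥0, β ≤ α → ∀ y : X β, (∃ x : X α, ev α β x y) →
    ∃ x : X α, ev α β x y ∧ lab α x = lab β y ∧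
      ∀ x' : X α, ev α β x' y → ∀ s s' : ℝ≥0, BornAt X ev x s → BornAt X ev x' s' → s' ≤ s
  /-- a label is kept only by evolution: newborn features have new labels -/
  fresh : ∀ α β : ℝ≥0, β ≤ α → ∀ (x : X α) (y : X β), lab α x = lab β y → ev α β x y

/-- `t` is the death scale of `x`: the infimum of the scales at which the label of `x` is
present. -/
def DiesAt {L : Type} (lab : ∀ α : ℝ≥0, X α → L) {α : ℝ≥0} (x : X α) (t : ℝ≥0) : Prop :=
  IsGLB {r : ℝ≥0 | ∃ y : X r, lab r y = lab α x} t

end Evolution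

end AlphaDuality

end

noncomputable section

namespace AlphaDuality

open Set Filter Topology

/-! ### Plane geometry in coordinates -/

/-! Every vertex of the triangulation belongs to C(α). The complement of |C(α)| is therefore glued
from the external region and the open triangles outside C(α) along the open edges missing from C(α).
Its components correspond to the classes of nodes generated by `Link`, the relation of having a
common side outside C(α) (`region_subset_component`, `eq_of_near_component`). The graph C*(α) only
uses sides longer than 2α and drops some triangles; the point is that this loses nothing.

A side longer than 2α is missing from C(α), so adjacency in C*(α) implies a link. The converse rests
on empty circumcircles. A missing side of length at most 2α is opposite to an obtuse angle of a
triangle (`exists_obtuseAt_of_short`), and never so on both of its sides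
(`ObtuseAt.eq_of_common_side`). A triangle outside C(α) that is not a vertex of C*(α) has only short
sides and is obtuse, and its longest side is missing as well (`ObtuseAt.not_mem_alphaComplex`). Pass
such a triangle on across its longest side. The longest sides strictly increase along this walk, so
it ends at a vertex of C*(α); this is the relation `Attached`. The dropped triangles thus hang on
the graph like trees, and a short missing side never joins two components (`Attached.eq_of_link`).
Hence every hole contains exactly one white component, every white component lies in a hole, and the
component of v₀ belongs to the unbounded region.

Contours correspond to holes because the boundary of a set of triangles is a cycle modulo 2, nonzero
if the set is nonempty (`exists_boundary_edge`); applied to the triangles of two holes, this also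
shows that a contour determines its hole. Inclusion of holes matches inclusion of white components
(`evolvesTo_iff`). Births and mergers are defined from the evolution relation alone, and deaths from
it and a labelling, so the bijections carry them over. -/

/-- Twice the signed area of the triangle `a b x`. -/
def cross (a b x : Plane) : ℝ :=
  (b 0 - a 0) * (x 1 - a 1) - (b 1 - a 1) * (x 0 - a 0)

theorem continuous_cross (a b : Plane) : Continuous (cross a b) := by
  unfold cross
  fun_prop

theorem cross_self_left (a b : Plane) : cross a b a = 0 := by unfold cross; ring

theorem cross_self_right (a b : Plane) : cross a b b = 0 := by unfold cross; ring

theorem cross_rotate (a b c : Plane) : cross b c a = cross a b c := by unfold cross; ring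

theorem cross_combo (a b p q : Plane) {u v : ℝ} (h : u + v = 1) :
    cross a b (u • p + v • q) = u * cross a b p + v * cross a b q := by
  obtain rfl : u = 1 - v := by linarith
  simp only [cross, PiLp.add_apply, PiLp.smul_apply, smul_eq_mul]
  ring

theorem cross_combo_three (a b p q r : Plane) {u v w : ℝ} (h : u + v + w = 1) :
    cross a b (u • p + v • q + w • r) =
      u * cross a b p + v * cross a b q + w * cross a b r := by
  obtain rfl : u = 1 - v - w := by linarith
  simp only [cross, PiLp.add_apply, PiLp.smul_apply, smul_eq_mul]
  ring

theorem plane_ext {x y : Plane} (h0 : x 0 = y 0) (h1 : x 1 = y 1) : x = y := by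
  ext i
  fin_cases i
  · exact h0
  · exact h1

theorem dist_sq_eq (p q : Plane) : dist p q ^ 2 = (p 0 - q 0) ^ 2 + (p 1 - q 1) ^ 2 := by
  rw [EuclideanSpace.dist_eq, Real.sq_sqrt (by positivity), Fin.sum_univ_two,
    Real.dist_eq, Real.dist_eq, sq_abs, sq_abs]

theorem sum_sq_pos_of_ne {a b : Plane} (h : a ≠ b) : 0 < (b 0 - a 0) ^ 2 + (b 1 - a 1) ^ 2 := by
  have := pow_pos (dist_pos.2 h.symm) 2
  rwa [dist_sq_eq] at this

theorem mem_convexHull_pair {a b x : Plane} :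
    x ∈ convexHull ℝ ({a, b} : Set Plane) ↔
      ∃ u v : ℝ, 0 ≤ u ∧ 0 ≤ v ∧ u + v = 1 ∧ u • a + v • b = x := by
  rw [convexHull_pair]
  simp [segment]

theorem mem_convexHull_three {a b c x : Plane} :
    x ∈ convexHull ℝ ({a, b, c} : Set Plane) ↔
      ∃ u v w : ℝ, 0 ≤ u ∧ 0 ≤ v ∧ 0 ≤ w ∧ u + v + w = 1 ∧ u • a + v • b + w • c = x := by
  constructor
  · intro h
    rw [convexHull_insert (by simp), mem_convexJoin] at h
    obtain ⟨p, hp, q, hq, hx⟩ := h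
    rw [mem_singleton_iff] at hp
    subst hp
    obtain ⟨v, w, hv, hw, hvw, rfl⟩ := mem_convexHull_pair.1 hq
    obtain ⟨s, t, hs, ht, hst, rfl⟩ := hx
    refine ⟨s, t * v, t * w, hs, by positivity, by positivity, ?_, ?_⟩
    · rw [add_assoc, ← mul_add, hvw, mul_one, hst]
    · rw [smul_add, smul_smul, smul_smul, add_assoc]
  · rintro ⟨u, v, w, hu, hv, hw, h, rfl⟩
    have hc := convex_convexHull ℝ ({a, b, c} : Set Plane)
    have := hc.sum_mem (t := Finset.univ) (w := ![u, v, w]) (z := ![a, b, c]) ?_ ?_ ?_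
    · simpa [Fin.sum_univ_three] using this
    · intro i _
      fin_cases i <;> simpa
    · simpa [Fin.sum_univ_three] using h
    · intro i _
      apply subset_convexHull
      fin_cases i <;> simp

theorem cross_eq_zero_of_mem_pair {a b x : Plane}
    (h : x ∈ convexHull ℝ ({a, b} : Set Plane)) : cross a b x = 0 := by
  obtain ⟨u, v, -, -, huv, rfl⟩ := mem_convexHull_pair.1 h
  rw [cross_combo _ _ _ _ huv, cross_self_left, cross_self_right]
  ring

theorem cross_mul_nonneg_of_mem {a b c x : Plane}
    (h : x ∈ convexHull ℝ ({a, b, c} : Set Plane)) : 0 ≤ cross a b x * cross a b c := by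
  obtain ⟨u, v, w, -, -, hw, huv, rfl⟩ := mem_convexHull_three.1 h
  rw [cross_combo_three _ _ _ _ _ huv, cross_self_left, cross_self_right]
  have := mul_nonneg hw (mul_self_nonneg (cross a b c))
  linarith

theorem triple_rotate (a b c : Plane) : ({b, c, a} : Set Plane) = {a, b, c} := by
  ext x
  simp only [mem_insert_iff, mem_singleton_iff]
  tauto

/-- The three products divided by `cross a b c ^ 2` are the barycentric coordinates of `x`. The
factor `cross a b c` makes the signs independent of the orientation of the triangle. -/
theorem mem_convexHull_three_iff {a b c x : Plane} (hD : cross a b c ≠ 0) :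
    x ∈ convexHull ℝ ({a, b, c} : Set Plane) ↔
      0 ≤ cross a b x * cross a b c ∧ 0 ≤ cross b c x * cross a b c ∧
        0 ≤ cross c a x * cross a b c := by
  constructor
  · intro h
    refine ⟨cross_mul_nonneg_of_mem h, ?_, ?_⟩
    · rw [← cross_rotate a b c]
      exact cross_mul_nonneg_of_mem (by rwa [triple_rotate])
    · rw [← cross_rotate a b c, ← cross_rotate b c a]
      exact cross_mul_nonneg_of_mem (by rwa [triple_rotate, triple_rotate])
  · rintro ⟨h1, h2, h3⟩
    have hsq : 0 < cross a b c ^ 2 := by positivity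
    rw [mem_convexHull_three]
    refine ⟨cross b c x * cross a b c / cross a b c ^ 2,
      cross c a x * cross a b c / cross a b c ^ 2,
      cross a b x * cross a b c / cross a b c ^ 2, by positivity, by positivity,
      by positivity, ?_, ?_⟩
    · field_simp
      unfold cross
      ring
    · apply plane_ext
      · simp only [PiLp.add_apply, PiLp.smul_apply, smul_eq_mul]
        field_simp
        unfold cross
        ring
      · simp only [PiLp.add_apply, PiLp.smul_apply, smul_eq_mul]
        field_simp
        unfold cross
        ring

theorem cross_mul_pos_of_mem_interior {a b c x : Plane} (hD : cross a b c ≠ 0)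
    (h : x ∈ interior (convexHull ℝ ({a, b, c} : Set Plane))) :
    0 < cross a b x * cross a b c := by
  -- Pushing `x` slightly away from `c` stays in the triangle, but it would cross the line `a b` if
  -- `x` were on it.
  have hlim : Tendsto (fun ε : ℝ => (1 + ε) • x + (-ε) • c) (𝓝[>] 0) (𝓝 x) := by
    have : Continuous (fun ε : ℝ => (1 + ε) • x + (-ε) • c) := by fun_prop
    have := this.tendsto 0
    simp only [add_zero, one_smul, neg_zero, zero_smul] at this
    exact this.mono_left nhdsWithin_le_nhds
  have hev := hlim.eventually (mem_interior_iff_mem_nhds.1 h)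
  obtain ⟨ε, hmem, hε⟩ := (hev.and self_mem_nhdsWithin).exists
  have hε : 0 < ε := hε
  have := cross_mul_nonneg_of_mem hmem
  rw [cross_combo _ _ _ _ (by ring)] at this
  have hsq : 0 < cross a b c ^ 2 := by positivity
  by_contra hcon
  nlinarith [mul_pos hε hsq]

theorem mem_interior_three_iff {a b c x : Plane} (hD : cross a b c ≠ 0) :
    x ∈ interior (convexHull ℝ ({a, b, c} : Set Plane)) ↔
      0 < cross a b x * cross a b c ∧ 0 < cross b c x * cross a b c ∧
        0 < cross c a x * cross a b c := by
  constructor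
  · intro h
    have hD' := hD
    rw [← cross_rotate a b c] at hD'
    have hD'' := hD'
    rw [← cross_rotate b c a] at hD''
    refine ⟨cross_mul_pos_of_mem_interior hD h, ?_, ?_⟩
    · rw [← cross_rotate a b c]
      exact cross_mul_pos_of_mem_interior hD' (by rwa [triple_rotate])
    · rw [← cross_rotate a b c, ← cross_rotate b c a]
      exact cross_mul_pos_of_mem_interior hD'' (by rwa [triple_rotate, triple_rotate])
  · rintro ⟨h1, h2, h3⟩
    rw [mem_interior]
    refine ⟨{y | 0 < cross a b y * cross a b c} ∩ ({y | 0 < cross b c y * cross a b c} ∩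
      {y | 0 < cross c a y * cross a b c}), ?_, ?_, ⟨h1, h2, h3⟩⟩
    · rintro y ⟨h1, h2, h3⟩
      exact (mem_convexHull_three_iff hD).2 ⟨le_of_lt h1, le_of_lt h2, le_of_lt h3⟩
    · have h : ∀ p q : Plane, IsOpen {y | 0 < cross p q y * cross a b c} := fun p q =>
        isOpen_lt continuous_const ((continuous_cross p q).mul continuous_const)
      exact (h _ _).inter ((h _ _).inter (h _ _))

/-- Near an inner point of the side `a b`, the triangle `a b c` is a half-plane. -/
theorem eventually_mem_triangle_of_side {a b c : Plane} (hD : cross a b c ≠ 0) {u v : ℝ}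
    (hu : 0 < u) (hv : 0 < v) (huv : u + v = 1) :
    ∀ᶠ y in 𝓝 (u • a + v • b), 0 ≤ cross a b y * cross a b c →
      y ∈ convexHull ℝ ({a, b, c} : Set Plane) := by
  have hsq : 0 < cross a b c * cross a b c := mul_self_pos.2 hD
  have h1 : 0 < cross b c (u • a + v • b) * cross a b c := by
    rw [cross_combo _ _ _ _ huv, cross_rotate, cross_self_left]
    have := mul_pos hu hsq
    linarith
  have h2 : 0 < cross c a (u • a + v • b) * cross a b c := by
    rw [cross_combo _ _ _ _ huv, cross_self_right, cross_rotate b c a, cross_rotate a b c]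
    have := mul_pos hv hsq
    linarith
  have e1 := (((continuous_cross b c).mul continuous_const).tendsto _).eventually (lt_mem_nhds h1)
  have e2 := (((continuous_cross c a).mul continuous_const).tendsto _).eventually (lt_mem_nhds h2)
  filter_upwards [e1, e2] with y hy1 hy2 hy
  exact (mem_convexHull_three_iff hD).2 ⟨hy, hy1.le, hy2.le⟩

theorem cross_ne_zero_of_affineIndependent {a b c : Plane}
    (h : AffineIndependent ℝ ![a, b, c]) : cross a b c ≠ 0 := by
  intro h0
  have hab : a ≠ b := fun hab => by
    have := h.injective (a₁ := 0) (a₂ := 1) (by simpa using hab)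
    simp at this
  rw [affineIndependent_iff_not_collinear_set] at h
  apply h
  have hs := sum_sq_pos_of_ne hab
  rw [collinear_iff_of_mem (p₀ := a) (by simp)]
  refine ⟨b - a, ?_⟩
  intro p hp
  simp only [mem_insert_iff, mem_singleton_iff] at hp
  rcases hp with rfl | rfl | rfl
  · exact ⟨0, by simp⟩
  · exact ⟨1, by simp⟩
  -- The coefficient of the orthogonal projection to the line `a b`; vanishing of `cross` makes the
  -- projection the point itself.
  · refine ⟨((p 0 - a 0) * (b 0 - a 0) + (p 1 - a 1) * (b 1 - a 1)) /
      ((b 0 - a 0) ^ 2 + (b 1 - a 1) ^ 2), ?_⟩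
    unfold cross at h0
    apply plane_ext
    · simp only [vadd_eq_add, PiLp.add_apply, PiLp.smul_apply, PiLp.sub_apply, smul_eq_mul]
      field_simp
      linear_combination -(b 1 - a 1) * h0
    · simp only [vadd_eq_add, PiLp.add_apply, PiLp.smul_apply, PiLp.sub_apply, smul_eq_mul]
      field_simp
      linear_combination (b 0 - a 0) * h0

theorem affineIndependent_triple_of_coe {a b c : Plane} {t : Finset Plane}
    (ht : t = {a, b, c}) (hcard : t.card = 3)
    (h : AffineIndependent ℝ ((↑) : t → Plane)) : AffineIndependent ℝ ![a, b, c] := by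
  subst ht
  have hab : a ≠ b := by
    rintro rfl
    have := Finset.card_le_two (a := a) (b := c)
    simp at hcard
    omega
  have hac : a ≠ c := by
    rintro rfl
    have := Finset.card_le_two (a := a) (b := b)
    rw [Finset.pair_comm b a] at hcard
    simp at hcard
    omega
  have hbc : b ≠ c := by
    rintro rfl
    have := Finset.card_le_two (a := a) (b := b)
    simp at hcard
    omega
  let f : Fin 3 → ({a, b, c} : Finset Plane) := ![⟨a, by simp⟩, ⟨b, by simp⟩, ⟨c, by simp⟩]
  have hf : Function.Injective f := by
    intro i j hij
    fin_cases i <;> fin_cases j <;> simp_all [f]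
  have := h.comp_embedding ⟨f, hf⟩
  convert this using 1
  funext i
  fin_cases i <;> rfl

/-! ### Faces of a planar simplicial complex -/

theorem exists_third_vertex {a b : Plane} (hab : a ≠ b) {t : Finset Plane}
    (h : {a, b} ⊆ t) (ht : t.card = 3) : ∃ c, c ≠ a ∧ c ≠ b ∧ t = {a, b, c} := by
  have h2 : ({a, b} : Finset Plane).card = 2 := Finset.card_pair hab
  have : (t \ {a, b}).card = 1 := by
    rw [Finset.card_sdiff_of_subset h]
    omega
  obtain ⟨c, hc⟩ := Finset.card_eq_one.1 this
  have hc' : c ∈ t \ {a, b} := by simp [hc]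
  simp only [Finset.mem_sdiff, Finset.mem_insert, Finset.mem_singleton, not_or] at hc'
  refine ⟨c, hc'.2.1, hc'.2.2, ?_⟩
  rw [← Finset.sdiff_union_of_subset h, hc]
  ext x
  simp only [Finset.mem_union, Finset.mem_insert, Finset.mem_singleton]
  tauto

theorem coe_triple {a b c : Plane} {t : Finset Plane} (h : t = {a, b, c}) :
    (t : Set Plane) = {a, b, c} := by
  subst h
  push_cast
  rfl

section Faces

variable {K : Geometry.SimplicialComplex ℝ Plane}

theorem card_face_le {s : Finset Plane} (hs : s ∈ K.faces) : s.card ≤ 3 := by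
  have := (K.indep hs).card_le_finrank_succ
  have h2 := Submodule.finrank_le (vectorSpan ℝ (range ((↑) : s → Plane)))
  rw [finrank_euclideanSpace_fin] at h2
  rw [Fintype.card_coe] at this
  omega

theorem cross_ne_zero_of_face {a b c : Plane} {t : Finset Plane} (ht : t ∈ K.faces)
    (hcard : t.card = 3) (h : t = {a, b, c}) : cross a b c ≠ 0 :=
  cross_ne_zero_of_affineIndependent (affineIndependent_triple_of_coe h hcard (K.indep ht))

/-- Faces meet in the hull of their common vertices. If an endpoint were not in `s`, this hull would
contain at most the other endpoint, and not a point strictly between the two. -/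
theorem edge_subset_of_mem {a b : Plane} (hab : a ≠ b) (he : {a, b} ∈ K.faces)
    {s : Finset Plane} (hs : s ∈ K.faces) {u v : ℝ} (hu : 0 < u) (hv : 0 < v) (huv : u + v = 1)
    (hx : u • a + v • b ∈ convexHull ℝ (s : Set Plane)) : {a, b} ⊆ s := by
  have hmem : u • a + v • b ∈ convexHull ℝ (({a, b} : Finset Plane) : Set Plane) := by
    push_cast
    exact mem_convexHull_pair.2 ⟨u, v, hu.le, hv.le, huv, rfl⟩
  have hi := K.inter_subset_convexHull he hs ⟨hmem, hx⟩
  have key : ∀ p, p ∉ s → ((({a, b} : Finset Plane) : Set Plane) ∩ s) ⊆ {a, b} \ {p} := by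
    intro p hp y hy
    refine ⟨by simpa using hy.1, ?_⟩
    rintro rfl
    exact hp hy.2
  have hsub : ∀ q : Plane, ((({a, b} : Finset Plane) : Set Plane) ∩ s) ⊆ {q} →
      u • a + v • b = q := by
    intro q hq
    have := convexHull_mono hq hi
    simpa using this
  intro p hp
  by_contra hps
  have hk := key p hps
  simp only [Finset.mem_insert, Finset.mem_singleton] at hp
  rcases hp with rfl | rfl
  · have := hsub b (hk.trans (by intro y; simp; tauto))
    have h0 : u • (p - b) = 0 := by
      obtain rfl : v = 1 - u := by linarith
      rw [sub_smul, one_smul] at this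
      rw [smul_sub]
      rw [← sub_eq_zero] at this
      rw [← this]
      abel
    rcases smul_eq_zero.1 h0 with h | h
    · exact hu.ne' h
    · exact hab (sub_eq_zero.1 h)
  · have := hsub a (hk.trans (by intro y; simp; tauto))
    have h0 : v • (p - a) = 0 := by
      obtain rfl : u = 1 - v := by linarith
      rw [sub_smul, one_smul] at this
      rw [smul_sub]
      rw [← sub_eq_zero] at this
      rw [← this]
      abel
    rcases smul_eq_zero.1 h0 with h | h
    · exact hv.ne' h
    · exact hab (sub_eq_zero.1 h).symm

/-- If a vertex of `t` were not in `s`, the two faces would meet inside the opposite side of `t`,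
which contains no interior point. -/
theorem triangle_subset_of_mem {t s : Finset Plane} (ht : t ∈ K.faces) (hcard : t.card = 3)
    (hs : s ∈ K.faces) {x : Plane} (hx : x ∈ openTriangle t)
    (hxs : x ∈ convexHull ℝ (s : Set Plane)) : t ⊆ s := by
  have hi := K.inter_subset_convexHull ht hs ⟨interior_subset hx, hxs⟩
  intro p hp
  by_contra hps
  have h2 : (t.erase p).card = 2 := by rw [Finset.card_erase_of_mem hp, hcard]
  obtain ⟨a, b, hab, hab'⟩ := Finset.card_eq_two.1 h2
  have htp : t = {a, b, p} := by
    rw [← Finset.insert_erase hp, hab']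
    ext y
    simp only [Finset.mem_insert, Finset.mem_singleton]
    tauto
  have hsub : ((t : Set Plane) ∩ s) ⊆ {a, b} := by
    rintro y ⟨hy1, hy2⟩
    have : y ∈ t.erase p := Finset.mem_erase.2 ⟨fun h => hps (h ▸ hy2), hy1⟩
    rw [hab'] at this
    simpa using this
  have h0 := cross_eq_zero_of_mem_pair (convexHull_mono hsub hi)
  unfold openTriangle at hx
  rw [coe_triple htp] at hx
  have := cross_mul_pos_of_mem_interior (cross_ne_zero_of_face ht hcard htp) hx
  rw [h0, zero_mul] at this
  exact lt_irrefl _ this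

theorem isClosed_hull (s : Finset Plane) : IsClosed (convexHull ℝ (s : Set Plane)) :=
  (s.finite_toSet.isCompact_convexHull ℝ).isClosed

/-- Points near `x` lie only in closed faces that contain `x`. -/
theorem eventually_mem_face_imp (hfin : K.faces.Finite) (x : Plane) :
    ∀ᶠ y in 𝓝 x, ∀ s ∈ K.faces, y ∈ convexHull ℝ (s : Set Plane) →
      x ∈ convexHull ℝ (s : Set Plane) := by
  rw [eventually_all_finite hfin]
  intro s _
  by_cases hx : x ∈ convexHull ℝ (s : Set Plane)
  · exact Eventually.of_forall fun _ _ => hx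
  · filter_upwards [(isClosed_hull s).isOpen_compl.mem_nhds hx] with y hy hy'
    exact absurd hy' hy

/-- Two triangles with a common side lie on opposite sides of it. -/
theorem opposite_sides {a b c c' : Plane} {t t' : Finset Plane} (ht : t ∈ K.faces)
    (ht' : t' ∈ K.faces) (hcard : t.card = 3) (hcard' : t'.card = 3)
    (hc : t = {a, b, c}) (hc' : t' = {a, b, c'}) (hne : t ≠ t') :
    cross a b c * cross a b c' < 0 := by
  have hD := cross_ne_zero_of_face ht hcard hc
  have hD' := cross_ne_zero_of_face ht' hcard' hc'
  by_contra hcon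
  have hpos : 0 < cross a b c * cross a b c' :=
    lt_of_le_of_ne (not_lt.1 hcon) (mul_ne_zero hD hD').symm
  have hcc : c ≠ c' := by
    rintro rfl
    exact hne (hc.trans hc'.symm)
  set x : Plane := (1 / 2 : ℝ) • a + (1 / 2 : ℝ) • b with hx
  have e1 := eventually_mem_triangle_of_side hD (u := 1 / 2) (v := 1 / 2) (by norm_num)
    (by norm_num) (by norm_num)
  have e2 := eventually_mem_triangle_of_side hD' (u := 1 / 2) (v := 1 / 2) (by norm_num)
    (by norm_num) (by norm_num)
  -- If the triangles were on the same side, a point slightly off the midpoint towards `c` would lie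
  -- in both, although they can only meet along `a b`.
  have hlim : Tendsto (fun ε : ℝ => (1 - ε) • x + ε • c) (𝓝[>] 0) (𝓝 x) := by
    have : Continuous (fun ε : ℝ => (1 - ε) • x + ε • c) := by fun_prop
    have := this.tendsto 0
    simp only [sub_zero, one_smul, zero_smul, add_zero] at this
    exact this.mono_left nhdsWithin_le_nhds
  obtain ⟨ε, ⟨h1, h2⟩, hε⟩ :=
    ((hlim.eventually (e1.and e2)).and self_mem_nhdsWithin).exists
  have hε : 0 < ε := hε
  have hcr : cross a b ((1 - ε) • x + ε • c) = ε * cross a b c := by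
    rw [cross_combo _ _ _ _ (by ring), hx, cross_combo _ _ _ _ (by norm_num), cross_self_left,
      cross_self_right]
    ring
  have hsq : 0 < cross a b c * cross a b c := mul_self_pos.2 hD
  have m1 := h1 (by rw [hcr]; nlinarith [mul_pos hε hsq])
  have m2 := h2 (by rw [hcr]; nlinarith [mul_pos hε hpos])
  rw [← coe_triple hc] at m1
  rw [← coe_triple hc'] at m2
  have hi := K.inter_subset_convexHull ht ht' ⟨m1, m2⟩
  have hsub : ((t : Set Plane) ∩ t') ⊆ {a, b} := by
    rw [coe_triple hc, coe_triple hc']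
    rintro y ⟨hy, hy'⟩
    simp only [mem_insert_iff, mem_singleton_iff] at hy hy' ⊢
    rcases hy with h | h | h
    · exact Or.inl h
    · exact Or.inr h
    · rcases hy' with h' | h' | h'
      · exact Or.inl h'
      · exact Or.inr h'
      · exact absurd (h.symm.trans h') hcc
  have h0 := cross_eq_zero_of_mem_pair (convexHull_mono hsub hi)
  rw [hcr] at h0
  exact (mul_ne_zero hε.ne' hD) h0

/-- An edge is a side of at most two triangles. -/
theorem eq_or_eq_of_common_side {e t₁ t₂ t₃ : Finset Plane} (he : e.card = 2)
    (h₁ : t₁ ∈ K.faces ∧ t₁.card = 3 ∧ e ⊆ t₁) (h₂ : t₂ ∈ K.faces ∧ t₂.card = 3 ∧ e ⊆ t₂)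
    (h₃ : t₃ ∈ K.faces ∧ t₃.card = 3 ∧ e ⊆ t₃) (h12 : t₁ ≠ t₂) : t₃ = t₁ ∨ t₃ = t₂ := by
  obtain ⟨a, b, hab, rfl⟩ := Finset.card_eq_two.1 he
  obtain ⟨c₁, -, -, hc₁⟩ := exists_third_vertex hab h₁.2.2 h₁.2.1
  obtain ⟨c₂, -, -, hc₂⟩ := exists_third_vertex hab h₂.2.2 h₂.2.1
  obtain ⟨c₃, -, -, hc₃⟩ := exists_third_vertex hab h₃.2.2 h₃.2.1
  -- Three distinct triangles would lie pairwise on opposite sides, but a line has only two sides.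
  by_contra! hcon
  have k12 := opposite_sides h₁.1 h₂.1 h₁.2.1 h₂.2.1 hc₁ hc₂ h12
  have k31 := opposite_sides h₃.1 h₁.1 h₃.2.1 h₁.2.1 hc₃ hc₁ hcon.1
  have k32 := opposite_sides h₃.1 h₂.1 h₃.2.1 h₂.2.1 hc₃ hc₂ hcon.2
  have := mul_pos_of_neg_of_neg k31 k32
  have h3 := mul_neg_of_pos_of_neg
    (mul_self_pos.2 (cross_ne_zero_of_face h₃.1 h₃.2.1 hc₃)) k12
  linarith [this, h3]

/-- On every side of an edge on which the space of a convex complex extends there is a triangle. -/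
theorem exists_triangle_on_side (hfin : K.faces.Finite) (hconv : Convex ℝ K.space)
    {a b y : Plane} (hab : a ≠ b) (he : {a, b} ∈ K.faces) (hy : y ∈ K.space)
    (hcr : cross a b y ≠ 0) :
    ∃ t ∈ K.faces, t.card = 3 ∧ ∃ c, c ≠ a ∧ c ≠ b ∧ t = {a, b, c} ∧
      0 < cross a b c * cross a b y := by
  set x : Plane := (1 / 2 : ℝ) • a + (1 / 2 : ℝ) • b with hx
  have hxK : x ∈ K.space := by
    refine K.convexHull_subset_space he ?_
    push_cast
    exact mem_convexHull_pair.2 ⟨1 / 2, 1 / 2, by norm_num, by norm_num, by norm_num, rfl⟩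
  -- Move from the midpoint towards `y`. By convexity the point stays in the space; a face
  -- containing it contains the midpoint too if the move is small, hence the whole edge, and it is
  -- not the edge itself.
  have hlim : Tendsto (fun ε : ℝ => (1 - ε) • x + ε • y) (𝓝[>] 0) (𝓝 x) := by
    have : Continuous (fun ε : ℝ => (1 - ε) • x + ε • y) := by fun_prop
    have := this.tendsto 0
    simp only [sub_zero, one_smul, zero_smul, add_zero] at this
    exact this.mono_left nhdsWithin_le_nhds
  have hlt : ∀ᶠ ε : ℝ in 𝓝[>] 0, ε < 1 := nhdsWithin_le_nhds (gt_mem_nhds one_pos)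
  obtain ⟨ε, ⟨hev, hε1⟩, hε⟩ := (((hlim.eventually (eventually_mem_face_imp hfin x)).and
    hlt).and self_mem_nhdsWithin).exists
  have hε : 0 < ε := hε
  have hcr' : cross a b ((1 - ε) • x + ε • y) = ε * cross a b y := by
    rw [cross_combo _ _ _ _ (by ring), hx, cross_combo _ _ _ _ (by norm_num), cross_self_left,
      cross_self_right]
    ring
  have hzK : (1 - ε) • x + ε • y ∈ K.space :=
    hconv hxK hy (by linarith) hε.le (by ring)
  obtain ⟨s, hs, hzs⟩ := Geometry.SimplicialComplex.mem_space_iff.1 hzK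
  have hsub := edge_subset_of_mem hab he hs (by norm_num) (by norm_num) (by norm_num)
    (hev s hs hzs)
  have hcard : s.card = 3 := by
    by_contra hne
    have h2 : s.card ≤ ({a, b} : Finset Plane).card := by
      rw [Finset.card_pair hab]
      have := card_face_le hs
      omega
    have heq := Finset.eq_of_subset_of_card_le hsub h2
    rw [← heq] at hzs
    push_cast at hzs
    have := cross_eq_zero_of_mem_pair hzs
    rw [hcr'] at this
    exact mul_ne_zero hε.ne' hcr this
  obtain ⟨c, hca, hcb, hc⟩ := exists_third_vertex hab hsub hcard
  refine ⟨s, hs, hcard, c, hca, hcb, hc, ?_⟩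
  rw [coe_triple hc] at hzs
  have h := cross_mul_nonneg_of_mem hzs
  rw [hcr', mul_assoc] at h
  have h' := nonneg_of_mul_nonneg_right h hε
  rw [mul_comm]
  exact lt_of_le_of_ne h' (mul_ne_zero hcr (cross_ne_zero_of_face hs hcard hc)).symm

/-- An inner point of a common side of two triangles is interior to their union. -/
theorem mem_interior_union_of_common_side {a b : Plane} {t t' : Finset Plane}
    (ht : t ∈ K.faces) (ht' : t' ∈ K.faces) (hcard : t.card = 3) (hcard' : t'.card = 3)
    (hab : a ≠ b) (h : {a, b} ⊆ t) (h' : {a, b} ⊆ t') (hne : t ≠ t') {u v : ℝ}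
    (hu : 0 < u) (hv : 0 < v) (huv : u + v = 1) :
    u • a + v • b ∈ interior (convexHull ℝ (t : Set Plane) ∪ convexHull ℝ (t' : Set Plane)) := by
  obtain ⟨c, -, -, hc⟩ := exists_third_vertex hab h hcard
  obtain ⟨c', -, -, hc'⟩ := exists_third_vertex hab h' hcard'
  have hlt := opposite_sides ht ht' hcard hcard' hc hc' hne
  rw [mem_interior_iff_mem_nhds]
  filter_upwards [eventually_mem_triangle_of_side (cross_ne_zero_of_face ht hcard hc) hu hv huv,
    eventually_mem_triangle_of_side (cross_ne_zero_of_face ht' hcard' hc') hu hv huv]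
    with y hy hy'
  rw [coe_triple hc, coe_triple hc']
  rcases le_total 0 (cross a b y * cross a b c) with hle | hle
  · exact Or.inl (hy hle)
  · refine Or.inr (hy' ?_)
    by_contra hcon
    have h1 := mul_nonneg_of_nonpos_of_nonpos hle (not_le.1 hcon).le
    have h2 : 0 ≤ cross a b y * cross a b y := mul_self_nonneg _
    have h3 : cross a b y ≠ 0 := by
      intro h0
      rw [h0, zero_mul] at hcon
      exact hcon le_rfl
    have h4 := mul_neg_of_pos_of_neg (mul_self_pos.2 h3) hlt
    linarith

/-- A point of a triangle is a vertex, an inner point of a side, or interior. -/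
theorem triangle_point_cases {t : Finset Plane} (ht : t ∈ K.faces) (hcard : t.card = 3)
    {x : Plane} (hx : x ∈ convexHull ℝ (t : Set Plane)) :
    x ∈ t ∨ (∃ a b, a ≠ b ∧ {a, b} ⊆ t ∧ ∃ u v : ℝ, 0 < u ∧ 0 < v ∧ u + v = 1 ∧
      u • a + v • b = x) ∨ x ∈ openTriangle t := by
  obtain ⟨a, b, c, hab, hac, hbc, h⟩ := Finset.card_eq_three.1 hcard
  have hD := cross_ne_zero_of_face ht hcard h
  have hpair : ∀ p q : Plane, p ≠ q → {p, q} ⊆ t → ∀ u v : ℝ, 0 ≤ u → 0 ≤ v → u + v = 1 →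
      u • p + v • q = x → x ∈ t ∨ (∃ a b, a ≠ b ∧ {a, b} ⊆ t ∧ ∃ u v : ℝ, 0 < u ∧ 0 < v ∧
        u + v = 1 ∧ u • a + v • b = x) := by
    intro p q hpq hsub u v hu hv huv hxe
    rcases hu.eq_or_lt with rfl | hu
    · left
      obtain rfl : v = 1 := by linarith
      apply hsub
      simp [← hxe]
    rcases hv.eq_or_lt with rfl | hv
    · left
      obtain rfl : u = 1 := by linarith
      apply hsub
      simp [← hxe]
    exact Or.inr ⟨p, q, hpq, hsub, u, v, hu, hv, huv, hxe⟩
  rw [← or_assoc]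
  rw [coe_triple h] at hx
  obtain ⟨u, v, w, hu, hv, hw, hsum, hxe⟩ := mem_convexHull_three.1 hx
  rcases hu.eq_or_lt with rfl | hu
  · exact Or.inl (hpair b c hbc (by rw [h]; intro; simp; tauto) v w hv hw (by linarith)
      (by rw [← hxe]; simp))
  rcases hv.eq_or_lt with rfl | hv
  · exact Or.inl (hpair a c hac (by rw [h]; intro; simp; tauto) u w hu.le hw (by linarith)
      (by rw [← hxe]; simp))
  rcases hw.eq_or_lt with rfl | hw
  · exact Or.inl (hpair a b hab (by rw [h]; intro; simp; tauto) u v hu.le hv.le (by linarith)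
      (by rw [← hxe]; simp))
  right
  unfold openTriangle
  rw [coe_triple h, mem_interior_three_iff hD, ← hxe]
  have hsq : 0 < cross a b c * cross a b c := mul_self_pos.2 hD
  rw [cross_combo_three _ _ _ _ _ hsum, cross_combo_three _ _ _ _ _ hsum,
    cross_combo_three _ _ _ _ _ hsum]
  simp only [cross_self_left, cross_self_right, cross_rotate b c a, cross_rotate a b c]
  refine ⟨?_, ?_, ?_⟩
  · nlinarith [mul_pos hw hsq]
  · nlinarith [mul_pos hu hsq]
  · nlinarith [mul_pos hv hsq]

end Faces

/-! ### Regions of the complement of a subcomplex -/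

theorem one_lt_rank_plane : 1 < Module.rank ℝ Plane := by
  rw [← Module.finrank_eq_rank, finrank_euclideanSpace_fin]
  norm_num

/-- The complement of a bounded convex set in the plane is connected. -/
theorem isPreconnected_compl_of_convex {A : Set Plane} (hA : Convex ℝ A)
    (hb : Bornology.IsBounded A) : IsPreconnected Aᶜ := by
  rcases A.eq_empty_or_nonempty with rfl | ⟨o, ho⟩
  · simpa using isPreconnected_univ
  obtain ⟨r, hr⟩ := hb.subset_closedBall o
  have hr0 : 0 ≤ r := by simpa using hr ho
  have hsphere : Metric.sphere o (r + 1) ⊆ Aᶜ := by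
    intro z hz hzA
    have h1 : dist z o ≤ r := hr hzA
    have h2 : dist z o = r + 1 := hz
    linarith
  obtain ⟨z₀, hz₀⟩ := (isConnected_sphere one_lt_rank_plane o
    (show 0 ≤ r + 1 by linarith)).nonempty
  refine isPreconnected_of_forall z₀ fun y hy => ?_
  have hyo : y ≠ o := fun h => hy (h ▸ ho)
  have hd : 0 < dist y o := dist_pos.2 hyo
  -- The radial projection `z` of `y` to a sphere outside `A`. All points are joined to this sphere
  -- along rays from `o`.
  set k : ℝ := (r + 1) / dist y o with hk
  have hk0 : 0 < k := by positivity
  set z : Plane := o + k • (y - o) with hz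
  have hzs : z ∈ Metric.sphere o (r + 1) := by
    rw [mem_sphere_iff_norm, hz, add_sub_cancel_left, norm_smul, Real.norm_of_nonneg hk0.le,
      ← dist_eq_norm, hk]
    field_simp
  have hseg : segment ℝ y z ⊆ Aᶜ := by
    rintro p ⟨u, v, hu, hv, huv, rfl⟩ hp
    set s : ℝ := u + v * k with hs
    have hpe : u • y + v • z = o + s • (y - o) := by
      rw [hz, hs]
      obtain rfl : u = 1 - v := by linarith
      module
    have hs0 : 0 < s := by
      rcases hu.eq_or_lt with rfl | hu
      · have : v = 1 := by linarith
        rw [hs, this]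
        linarith
      · have := mul_nonneg hv hk0.le
        linarith
    rw [hpe] at hp
    rcases le_or_gt 1 s with h1 | h1
    -- Here `y` lies between `o` and a point of `A`, so it would be in the convex set `A`.
    · apply hy
      have : y = (1 - 1 / s) • o + (1 / s) • (o + s • (y - o)) := by
        rw [smul_add, smul_smul, one_div_mul_cancel hs0.ne']
        module
      rw [this]
      refine hA ho hp ?_ (by positivity) (by ring)
      have : 1 / s ≤ 1 := by
        rw [div_le_one hs0]
        exact h1
      linarith
    -- Here `y` is beyond the sphere, and the whole segment stays at distance at least `r + 1` from
    -- `o`.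
    · have h2 : dist (o + s • (y - o)) o ≤ r := hr hp
      rw [dist_eq_norm, add_sub_cancel_left, norm_smul, Real.norm_of_nonneg hs0.le,
        ← dist_eq_norm] at h2
      have hks : k ≤ s := by
        have : k ≤ 1 := by
          by_contra hk1
          have := mul_nonneg hv (by linarith : 0 ≤ k - 1)
          nlinarith
        nlinarith
      have h3 := mul_le_mul_of_nonneg_right hks hd.le
      have h4 : k * dist y o = r + 1 := by
        rw [hk]
        field_simp
      linarith
  refine ⟨segment ℝ y z ∪ Metric.sphere o (r + 1), union_subset hseg hsphere, Or.inr hz₀,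
    Or.inl (left_mem_segment _ _ _), ?_⟩
  exact IsPreconnected.union z (right_mem_segment _ _ _) hzs
    (convex_segment y z).isPreconnected (isPreconnected_sphere one_lt_rank_plane o (r + 1))

/-- Finitely many vertices and edges are a null set, so they cannot cover a nonempty open part of
the space; `exists_near` relies on this. -/
theorem volume_hull_eq_zero {s : Finset Plane} (hs : s.card ≤ 2) :
    MeasureTheory.volume (convexHull ℝ (s : Set Plane)) = 0 := by
  rcases s.eq_empty_or_nonempty with rfl | hne
  · simp
  refine MeasureTheory.measure_mono_null (convexHull_subset_affineSpan _)
    (MeasureTheory.Measure.addHaar_affineSubspace _ _ fun htop => ?_)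
  have h1 : Module.finrank ℝ (vectorSpan ℝ (s : Set Plane)) ≤ 1 := by
    have hc : Fintype.card s = (s.card - 1) + 1 := by
      have := hne.card_pos
      rw [Fintype.card_coe]
      omega
    have := finrank_vectorSpan_range_le ℝ ((↑) : s → Plane) hc
    rw [Subtype.range_coe_subtype] at this
    refine le_trans this (by omega)
  rw [← direction_affineSpan, htop, AffineSubspace.direction_top, finrank_top,
    finrank_euclideanSpace_fin] at h1
  norm_num at h1

/-- The open region represented by a node of the dual graph. -/
def region (K : Geometry.SimplicialComplex ℝ Plane) : Node K → Set Plane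
  | some t => openTriangle t.1
  | none => K.spaceᶜ

/-- The point `x` belongs to the closed region represented by a node of the dual graph. -/
def Near (K : Geometry.SimplicialComplex ℝ Plane) (x : Plane) : Node K → Prop
  | some t => x ∈ convexHull ℝ (t.1 : Set Plane)
  | none => x ∉ interior K.space

/-- Two nodes have a common side that does not belong to `S`. -/
def Link (K S : Geometry.SimplicialComplex ℝ Plane) (v w : Node K) : Prop :=
  ∃ e, e ∉ S.faces ∧ IsSide K e v ∧ IsSide K e w

section Regions

variable {K S : Geometry.SimplicialComplex ℝ Plane}

theorem IsSide.card {e : Finset Plane} {v : Node K} (h : IsSide K e v) : e.card = 2 := by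
  cases v with
  | none => exact h.1
  | some t => exact h.1

theorem IsSide.mem_faces {e : Finset Plane} {v : Node K} (h : IsSide K e v) : e ∈ K.faces := by
  have hne : e.Nonempty := by
    rw [← Finset.card_pos, h.card]
    norm_num
  cases v with
  | none =>
    obtain ⟨t, ht, -⟩ := h.2
    exact K.down_closed ht.1 ht.2.2 hne
  | some t => exact K.down_closed t.2.1 h.2 hne

/-- A side of a triangle is also a side of another triangle or of the external region. -/
theorem exists_other_side {e t : Finset Plane} (he : e.card = 2) (ht : t ∈ K.faces)
    (hcard : t.card = 3) (het : e ⊆ t) :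
    ∃ w : Node K, w ≠ some ⟨t, ht, hcard⟩ ∧ IsSide K e w := by
  by_cases h : ∃ t' : Finset Plane, t' ≠ t ∧ t' ∈ K.faces ∧ t'.card = 3 ∧ e ⊆ t'
  · obtain ⟨t', hne, h1, h2, h3⟩ := h
    exact ⟨some ⟨t', h1, h2⟩, fun h => hne (by simpa using h), he, h3⟩
  · push Not at h
    refine ⟨none, by simp, he, t, ⟨ht, hcard, het⟩, fun t' ht' => ?_⟩
    by_contra hne
    exact h t' hne ht'.1 ht'.2.1 ht'.2.2

/-- An edge is a side of at most two nodes. -/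
theorem IsSide.eq_or_eq {e : Finset Plane} {v w x : Node K} (hv : IsSide K e v)
    (hw : IsSide K e w) (hx : IsSide K e x) (hvw : v ≠ w) : x = v ∨ x = w := by
  have key : ∀ (t t' : {t : Finset Plane // t ∈ K.faces ∧ t.card = 3}), IsSide K e none →
      IsSide K e (some t) → IsSide K e (some t') → t = t' := by
    rintro t t' ⟨-, s, -, hs⟩ ⟨-, h⟩ ⟨-, h'⟩
    exact Subtype.ext ((hs t.1 ⟨t.2.1, t.2.2, h⟩).trans (hs t'.1 ⟨t'.2.1, t'.2.2, h'⟩).symm)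
  have hcard := hv.card
  rcases v with _ | t₁ <;> rcases w with _ | t₂ <;> rcases x with _ | t₃
  · exact Or.inl rfl
  · exact absurd rfl hvw
  · exact Or.inl rfl
  · exact Or.inr (congrArg some (key _ _ hv hx hw))
  · exact Or.inr rfl
  · exact Or.inl (congrArg some (key _ _ hw hx hv))
  · exact absurd (congrArg some (key _ _ hx hv hw)) hvw
  · have hne : t₁.1 ≠ t₂.1 := fun h => hvw (congrArg some (Subtype.ext h))
    rcases eq_or_eq_of_common_side hcard ⟨t₁.2.1, t₁.2.2, hv.2⟩ ⟨t₂.2.1, t₂.2.2, hw.2⟩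
      ⟨t₃.2.1, t₃.2.2, hx.2⟩ hne with h | h
    · exact Or.inl (congrArg some (Subtype.ext h))
    · exact Or.inr (congrArg some (Subtype.ext h))

theorem isCompact_space (hfin : K.faces.Finite) : IsCompact K.space :=
  hfin.isCompact_biUnion fun s _ => s.finite_toSet.isCompact_convexHull ℝ

theorem openTriangle_nonempty {t : Finset Plane} (ht : t ∈ K.faces) (hcard : t.card = 3) :
    (openTriangle t).Nonempty := by
  obtain ⟨a, b, c, -, -, -, h⟩ := Finset.card_eq_three.1 hcard
  have hD := cross_ne_zero_of_face ht hcard h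
  have hsum : (1 / 3 : ℝ) + 1 / 3 + 1 / 3 = 1 := by norm_num
  have hsq : 0 < cross a b c * cross a b c := mul_self_pos.2 hD
  refine ⟨(1 / 3 : ℝ) • a + (1 / 3 : ℝ) • b + (1 / 3 : ℝ) • c, ?_⟩
  unfold openTriangle
  rw [coe_triple h, mem_interior_three_iff hD, cross_combo_three _ _ _ _ _ hsum,
    cross_combo_three _ _ _ _ _ hsum, cross_combo_three _ _ _ _ _ hsum]
  simp only [cross_self_left, cross_self_right, cross_rotate b c a, cross_rotate a b c]
  refine ⟨?_, ?_, ?_⟩ <;> linarith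

theorem region_nonempty (hfin : K.faces.Finite) (v : Node K) : (region K v).Nonempty := by
  cases v with
  | some t => exact openTriangle_nonempty t.2.1 t.2.2
  | none =>
    rw [region, nonempty_compl]
    intro h
    have := (isCompact_space hfin).isBounded
    rw [h] at this
    exact NormedSpace.unbounded_univ ℝ Plane this

theorem near_of_mem_region {x : Plane} {v : Node K} (h : x ∈ region K v) : Near K x v := by
  cases v with
  | some t => exact interior_subset (s := convexHull ℝ (t.1 : Set Plane)) h
  | none => exact fun h' => h (interior_subset h')

theorem not_isBounded_of_external_subset (hfin : K.faces.Finite) {R : Set Plane}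
    (h : region K none ⊆ R) : ¬ Bornology.IsBounded R := by
  intro hb
  have := (isCompact_space hfin).isBounded.union (hb.subset h)
  rw [region, union_compl_self] at this
  exact NormedSpace.unbounded_univ ℝ Plane this

/-- Every point belongs to a closed triangle or is not interior to the space. -/
theorem exists_near (hfin : K.faces.Finite) (x : Plane) : ∃ v : Node K, Near K x v := by
  by_cases hx : x ∈ interior K.space
  swap
  · exact ⟨none, hx⟩
  by_contra! hcon
  set F : Set (Finset Plane) := {t | t ∈ K.faces ∧ t.card = 3} with hF
  have hFfin : F.Finite := hfin.subset fun t ht => ht.1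
  set U : Set Plane := ⋃ t ∈ F, convexHull ℝ (t : Set Plane) with hU
  have hUcl : IsClosed U := hFfin.isClosed_biUnion fun t _ => isClosed_hull t
  have hxU : x ∉ U := by
    intro h
    obtain ⟨t, ht, hxt⟩ := mem_iUnion₂.1 h
    exact hcon (some ⟨t, ht⟩) hxt
  -- The points of the interior outside all triangles form an open set covered by vertices and
  -- edges, hence an open null set, which is empty.
  have hopen : IsOpen (interior K.space ∩ Uᶜ) := isOpen_interior.inter hUcl.isOpen_compl
  have hsub : interior K.space ∩ Uᶜ ⊆
      ⋃ s ∈ {s | s ∈ K.faces ∧ s.card ≤ 2}, convexHull ℝ (s : Set Plane) := by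
    rintro y ⟨hy, hyU⟩
    obtain ⟨s, hs, hys⟩ := Geometry.SimplicialComplex.mem_space_iff.1 (interior_subset hy)
    refine mem_iUnion₂.2 ⟨s, ⟨hs, ?_⟩, hys⟩
    by_contra h2
    have := card_face_le hs
    exact hyU (mem_iUnion₂.2 ⟨s, ⟨hs, by omega⟩, hys⟩)
  have hnull := MeasureTheory.measure_mono_null hsub
    ((MeasureTheory.measure_biUnion_null_iff (hfin.subset fun s hs => hs.1).countable
      (μ := MeasureTheory.volume)).2
      fun s hs => volume_hull_eq_zero hs.2)
  have := hopen.eq_empty_of_measure_zero hnull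
  have hmem : x ∈ interior K.space ∩ Uᶜ := ⟨hx, hxU⟩
  rw [this] at hmem
  exact hmem

theorem eventually_near_imp (hfin : K.faces.Finite) (x : Plane) :
    ∀ᶠ y in 𝓝 x, ∀ v : Node K, Near K y v → Near K x v := by
  have h2 : ∀ᶠ y in 𝓝 x, Near K y none → Near K x none := by
    by_cases hx : x ∈ interior K.space
    · filter_upwards [isOpen_interior.mem_nhds hx] with y hy h
      exact absurd hy h
    · exact Eventually.of_forall fun _ _ => hx
  filter_upwards [eventually_mem_face_imp hfin x, h2] with y h1 h2 v
  cases v with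
  | none => exact h2
  | some t => exact h1 t.1 t.2.1

theorem mem_space_of_vertex (hV : K.vertices ⊆ S.vertices) {t : Finset Plane}
    (ht : t ∈ K.faces) {x : Plane} (hx : x ∈ t) : x ∈ S.space := by
  apply S.vertices_subset_space
  apply hV
  rw [Geometry.SimplicialComplex.vertices_eq]
  exact mem_iUnion₂.2 ⟨t, ht, hx⟩

/-- As `S` contains all vertices, a point outside `S` where two regions meet is an inner point of a
common side, and this side is not in `S`. -/
theorem eq_or_link_of_near (hV : K.vertices ⊆ S.vertices) {x : Plane} (hx : x ∉ S.space)
    {v w : Node K} (hv : Near K x v) (hw : Near K x w) : v = w ∨ Link K S v w := by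
  have key : ∀ t, Near K x (some t) → Near K x none → Link K S (some t) none := by
    intro t ht h0
    rcases triangle_point_cases t.2.1 t.2.2 ht with h |
      ⟨a, b, hab, hsub, u, r, hu, hr, hur, rfl⟩ | h
    · exact absurd (mem_space_of_vertex hV t.2.1 h) hx
    · refine ⟨{a, b}, fun hS => hx ?_, ⟨Finset.card_pair hab, hsub⟩, Finset.card_pair hab, t.1,
        ⟨t.2.1, t.2.2, hsub⟩, fun t' ht' => ?_⟩
      · refine S.convexHull_subset_space hS ?_
        push_cast
        exact mem_convexHull_pair.2 ⟨u, r, hu.le, hr.le, hur, rfl⟩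
      · by_contra hne
        exact h0 (interior_mono (union_subset (K.convexHull_subset_space t.2.1)
          (K.convexHull_subset_space ht'.1)) (mem_interior_union_of_common_side t.2.1 ht'.1
            t.2.2 ht'.2.1 hab hsub ht'.2.2 (Ne.symm hne) hu hr hur))
    · exact absurd (interior_mono (K.convexHull_subset_space t.2.1) h) h0
  rcases v with _ | t <;> rcases w with _ | t'
  · exact Or.inl rfl
  · obtain ⟨e, h1, h2, h3⟩ := key t' hw hv
    exact Or.inr ⟨e, h1, h3, h2⟩
  · exact Or.inr (key t hv hw)
  · by_cases hne : t = t'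
    · exact Or.inl (congrArg some hne)
    right
    have hne' : t.1 ≠ t'.1 := fun h => hne (Subtype.ext h)
    have hi := K.inter_subset_convexHull t.2.1 t'.2.1 ⟨hv, hw⟩
    rw [← Finset.coe_inter] at hi
    set e := t.1 ∩ t'.1 with he
    have hene : e.Nonempty := by
      by_contra h
      rw [Finset.not_nonempty_iff_eq_empty.1 h] at hi
      simp at hi
    have heK : e ∈ K.faces := K.down_closed t.2.1 Finset.inter_subset_left hene
    have hcard : e.card = 2 := by
      have h1 : e.card ≠ 1 := by
        intro h1
        obtain ⟨p, hp⟩ := Finset.card_eq_one.1 h1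
        rw [hp] at hi
        have hxp : x = p := by simpa using hi
        exact hx (mem_space_of_vertex hV heK (by simp [hp, hxp]))
      have h3 : e.card < 3 := by
        by_contra h3
        have a1 := Finset.eq_of_subset_of_card_le (Finset.inter_subset_left : e ⊆ t.1)
          (by rw [t.2.2]; exact not_lt.1 h3)
        have a2 := Finset.eq_of_subset_of_card_le (Finset.inter_subset_right : e ⊆ t'.1)
          (by rw [t'.2.2]; exact not_lt.1 h3)
        exact hne' (a1.symm.trans a2)
      have := hene.card_pos
      omega
    exact ⟨e, fun hS => hx (S.convexHull_subset_space hS hi), ⟨hcard, Finset.inter_subset_left⟩,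
      hcard, Finset.inter_subset_right⟩

theorem openTriangle_subset_compl (hS : S.faces ⊆ K.faces) {t : Finset Plane}
    (ht : t ∈ K.faces) (hcard : t.card = 3) (htS : t ∉ S.faces) : openTriangle t ⊆ S.spaceᶜ := by
  intro y hy hyS
  obtain ⟨s, hs, hys⟩ := Geometry.SimplicialComplex.mem_space_iff.1 hyS
  exact htS (S.down_closed hs (triangle_subset_of_mem ht hcard (hS hs) hy hys)
    (K.nonempty_of_mem_faces ht))

theorem space_mono (hS : S.faces ⊆ K.faces) : S.space ⊆ K.space :=
  biUnion_subset_biUnion_left hS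

/-- The regions that are close to a point of the complement of `S` lie in its component. -/
theorem region_subset_component (hfin : K.faces.Finite) (hconv : Convex ℝ K.space)
    (hS : S.faces ⊆ K.faces) {x : Plane} (hx : x ∉ S.space) {v : Node K} (hv : Near K x v) :
    region K v ⊆ connectedComponentIn S.spaceᶜ x := by
  have hsub : region K v ⊆ S.spaceᶜ := by
    cases v with
    | some t =>
      exact openTriangle_subset_compl hS t.2.1 t.2.2
        fun h => hx (S.convexHull_subset_space h hv)
    | none => exact compl_subset_compl.2 (space_mono hS)
  have hpre : IsPreconnected (region K v) := by
    cases v with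
    | some t => exact (convex_convexHull ℝ (t.1 : Set Plane)).interior.isPreconnected
    | none => exact isPreconnected_compl_of_convex hconv (isCompact_space hfin).isBounded
  have hcl : x ∈ closure (region K v) := by
    cases v with
    | some t =>
      have hconvex := convex_convexHull ℝ (t.1 : Set Plane)
      have := hconvex.closure_interior_eq_closure_of_nonempty_interior
        (openTriangle_nonempty t.2.1 t.2.2)
      rw [region, openTriangle, this]
      exact subset_closure hv
    | none =>
      rw [region, closure_compl]
      exact hv
  -- The region with `x` added lies between a connected set and its closure, so it is connected.
  have := (hpre.subset_closure (subset_insert x _)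
    (insert_subset hcl subset_closure)).subset_connectedComponentIn (mem_insert x _)
    (insert_subset hx hsub)
  exact (subset_insert x _).trans this

/-- The midpoint of an edge outside `S` is in the complement of `S` and close to both regions. -/
theorem exists_near_of_side (hfin : K.faces.Finite) (hconv : Convex ℝ K.space)
    (hS : S.faces ⊆ K.faces) {e : Finset Plane} (heK : e ∈ K.faces) (hcard : e.card = 2)
    (heS : e ∉ S.faces) : ∃ x, x ∉ S.space ∧ ∀ v : Node K, IsSide K e v → Near K x v := by
  obtain ⟨a, b, hab, rfl⟩ := Finset.card_eq_two.1 hcard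
  set x : Plane := (1 / 2 : ℝ) • a + (1 / 2 : ℝ) • b with hx
  have hxe : x ∈ convexHull ℝ (({a, b} : Finset Plane) : Set Plane) := by
    push_cast
    exact mem_convexHull_pair.2 ⟨1 / 2, 1 / 2, by norm_num, by norm_num, by norm_num, rfl⟩
  refine ⟨x, ?_, ?_⟩
  · intro h
    obtain ⟨s, hs, hxs⟩ := Geometry.SimplicialComplex.mem_space_iff.1 h
    exact heS (S.down_closed hs (edge_subset_of_mem hab heK (hS hs) (by norm_num) (by norm_num)
      (by norm_num) hxs) (by simp))
  · intro v hv
    cases v with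
    | some t => exact convexHull_mono (Finset.coe_subset.2 hv.2) hxe
    | none =>
      obtain ⟨-, t, ⟨ht, htc, hsub⟩, huniq⟩ := hv
      obtain ⟨c, hca, hcb, hc⟩ := exists_third_vertex hab hsub htc
      have hD := cross_ne_zero_of_face ht htc hc
      intro hmemint
      -- If the midpoint were interior to the space, the space would extend across the edge, away
      -- from `c`, and there would be a second triangle there.
      have hlim : Tendsto (fun ε : ℝ => (1 + ε) • x + (-ε) • c) (𝓝[>] 0) (𝓝 x) := by
        have : Continuous (fun ε : ℝ => (1 + ε) • x + (-ε) • c) := by fun_prop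
        have := this.tendsto 0
        simp only [add_zero, one_smul, neg_zero, zero_smul] at this
        exact this.mono_left nhdsWithin_le_nhds
      obtain ⟨ε, hmem, hε⟩ := ((hlim.eventually (mem_interior_iff_mem_nhds.1 hmemint)).and
        self_mem_nhdsWithin).exists
      have hε : 0 < ε := hε
      have hcr : cross a b ((1 + ε) • x + (-ε) • c) = -ε * cross a b c := by
        rw [cross_combo _ _ _ _ (by ring), hx, cross_combo _ _ _ _ (by norm_num),
          cross_self_left, cross_self_right]
        ring
      obtain ⟨t', ht', htc', c', -, -, hc', hpos⟩ := exists_triangle_on_side hfin hconv hab heK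
        hmem (by rw [hcr]; exact mul_ne_zero (neg_ne_zero.2 hε.ne') hD)
      have heq := huniq t' ⟨ht', htc', by rw [hc']; intro y; simp; tauto⟩
      have hcc : cross a b c' * cross a b c ≥ 0 := by
        have hc'' : c' ∈ convexHull ℝ ({a, b, c} : Set Plane) := by
          rw [← coe_triple hc, ← heq, coe_triple hc']
          exact subset_convexHull ℝ _ (by simp)
        exact cross_mul_nonneg_of_mem hc''
      rw [hcr] at hpos
      nlinarith

/-- A function on the nodes that is constant along links is constant on the components of the
complement of `S`. -/
theorem eq_of_near_component {Y : Type*} (hfin : K.faces.Finite)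
    (hV : K.vertices ⊆ S.vertices) (ρ : Node K → Y) (hρ : ∀ v w, Link K S v w → ρ v = ρ w)
    {x y z : Plane} (hy : y ∈ connectedComponentIn S.spaceᶜ x)
    (hz : z ∈ connectedComponentIn S.spaceᶜ x) {v w : Node K} (hv : Near K y v)
    (hw : Near K z w) : ρ v = ρ w := by
  have h1 : ∀ p, p ∉ S.space → ∀ v w, Near K p v → Near K p w → ρ v = ρ w := by
    intro p hp v w hv hw
    rcases eq_or_link_of_near hV hp hv hw with rfl | h
    · rfl
    · exact hρ _ _ h
  -- The value of `ρ` at the regions near a point is well defined outside `S`, and locally constant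
  -- because regions near a neighbouring point are also near the point itself.
  have := (isPreconnected_connectedComponentIn (F := S.spaceᶜ) (x := x)).induction₂
    (fun p q => ∀ v w, Near K p v → Near K q w → ρ v = ρ w) ?_ ?_ ?_ hy hz
  · exact this v w hv hw
  · intro p hp
    filter_upwards [nhdsWithin_le_nhds (eventually_near_imp hfin p)] with q hq v w hv hw
    exact h1 p (connectedComponentIn_subset _ _ hp) v w hv (hq w hw)
  · intro p q r _ _ _ hpq hqr v w hv hw
    obtain ⟨m, hm⟩ := exists_near hfin q
    exact (hpq v m hv hm).trans (hqr m w hm hw)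
  · intro p q _ _ hpq v w hv hw
    exact (hpq w v hw hv).symm

/-- A nonempty set of triangles has an edge that lies in exactly one of them. -/
theorem exists_boundary_edge (hfin : K.faces.Finite) {T : Set (Finset Plane)}
    (hT : ∀ t ∈ T, t ∈ K.faces ∧ t.card = 3) (hne : T.Nonempty) :
    ∃ e : Finset Plane, e ∈ K.faces ∧ e.card = 2 ∧ ∃! t, t ∈ T ∧ e ⊆ t := by
  by_contra! hcon
  have hTfin : T.Finite := hfin.subset fun t ht => (hT t ht).1
  set U : Set Plane := ⋃ t ∈ T, convexHull ℝ (t : Set Plane) with hU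
  have hUcomp : IsCompact U :=
    hTfin.isCompact_biUnion fun s _ => s.finite_toSet.isCompact_convexHull ℝ
  set V : Set Plane := ⋃ t ∈ T, (t : Set Plane) with hVdef
  have hVfin : V.Finite := hTfin.biUnion fun t _ => t.finite_toSet
  -- If no edge were in exactly one triangle, the union `U` would be open and closed in the plane
  -- without the vertices, which is connected. This contradicts the boundedness of `U`.
  have hconn := (hVfin.countable.isConnected_compl_of_one_lt_rank one_lt_rank_plane).isPreconnected
  have hcover : Vᶜ ⊆ interior U ∪ Uᶜ := by
    intro x hx
    by_cases hxU : x ∈ U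
    swap
    · exact Or.inr hxU
    left
    obtain ⟨t, ht, hxt⟩ := mem_iUnion₂.1 hxU
    rcases triangle_point_cases (hT t ht).1 (hT t ht).2 hxt with
      h | ⟨a, b, hab, hsub, u, v, hu, hv, huv, rfl⟩ | h
    · exact absurd (mem_iUnion₂.2 ⟨t, ht, h⟩) hx
    · have heK : ({a, b} : Finset Plane) ∈ K.faces :=
        K.down_closed (hT t ht).1 hsub (by simp)
      have hnu := hcon {a, b} heK (Finset.card_pair hab)
      have : ∃ t', t' ∈ T ∧ {a, b} ⊆ t' ∧ t' ≠ t := by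
        by_contra! h
        exact hnu ⟨t, ⟨ht, hsub⟩, fun t' ht' => h t' ht'.1 ht'.2⟩
      obtain ⟨t', ht', hsub', hne'⟩ := this
      refine interior_mono ?_ (mem_interior_union_of_common_side (hT t ht).1 (hT t' ht').1
        (hT t ht).2 (hT t' ht').2 hab hsub hsub' hne'.symm hu hv huv)
      exact union_subset (subset_biUnion_of_mem (u := fun t : Finset Plane =>
        convexHull ℝ (t : Set Plane)) ht) (subset_biUnion_of_mem (u := fun t : Finset Plane =>
        convexHull ℝ (t : Set Plane)) ht')
    · exact interior_mono (subset_biUnion_of_mem (u := fun t : Finset Plane =>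
        convexHull ℝ (t : Set Plane)) ht) h
  have hdisj : Disjoint (interior U) Uᶜ :=
    disjoint_compl_right.mono_left interior_subset
  obtain ⟨t, ht⟩ := hne
  have hdense : Dense Vᶜ := hVfin.countable.dense_compl ℝ
  have h1 : (Vᶜ ∩ interior U).Nonempty := by
    have hopen : (interior U).Nonempty := (openTriangle_nonempty (hT t ht).1 (hT t ht).2).mono
      (interior_mono (subset_biUnion_of_mem (u := fun t : Finset Plane =>
        convexHull ℝ (t : Set Plane)) ht))
    rw [inter_comm]
    exact hdense.inter_open_nonempty _ isOpen_interior hopen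
  have h2 : (Vᶜ ∩ Uᶜ).Nonempty := by
    rw [inter_comm]
    refine hdense.inter_open_nonempty _ hUcomp.isClosed.isOpen_compl ?_
    rw [nonempty_compl]
    intro h
    exact NormedSpace.unbounded_univ ℝ Plane (h ▸ hUcomp.isBounded)
  obtain ⟨y, -, hy1, hy2⟩ := hconn (interior U) Uᶜ isOpen_interior hUcomp.isClosed.isOpen_compl
    hcover h1 h2
  exact hy2 (interior_subset hy1)

end Regions

/-! ### Metric properties of Delaunay triangles -/

/-- The inner product of `a - c` and `b - c`. -/
def dot (a b c : Plane) : ℝ := (a 0 - c 0) * (b 0 - c 0) + (a 1 - c 1) * (b 1 - c 1)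

theorem inner_vsub_eq_dot (a b c : Plane) : inner ℝ (a -ᵥ c) (b -ᵥ c) = dot a b c := by
  simp only [vsub_eq_sub, PiLp.inner_apply, Fin.sum_univ_two, PiLp.sub_apply, dot]
  simp
  ring

theorem angle_lt_pi_div_two_iff {a b c : Plane} :
    EuclideanGeometry.angle a c b < Real.pi / 2 ↔ 0 < dot a b c := by
  rw [EuclideanGeometry.angle, InnerProductGeometry.angle, Real.arccos_lt_pi_div_two,
    inner_vsub_eq_dot]
  constructor
  · intro h
    by_contra h'
    have := div_nonpos_of_nonpos_of_nonneg (not_lt.1 h')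
      (mul_nonneg (norm_nonneg (a -ᵥ c)) (norm_nonneg (b -ᵥ c)))
    linarith
  · intro h
    have ha : a ≠ c := by
      rintro rfl
      simp [dot] at h
    have hb : b ≠ c := by
      rintro rfl
      simp [dot] at h
    have h1 : 0 < ‖a -ᵥ c‖ := norm_pos_iff.2 (vsub_ne_zero.2 ha)
    have h2 : 0 < ‖b -ᵥ c‖ := norm_pos_iff.2 (vsub_ne_zero.2 hb)
    positivity

/-- Points on the perpendicular bisector of `a b`, parametrized. -/
theorem exists_bisector_param {a b y : Plane} (hab : a ≠ b) (h : dist a y = dist b y) :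
    ∃ s : ℝ, y 0 = (a 0 + b 0) / 2 - s * (b 1 - a 1) ∧
      y 1 = (a 1 + b 1) / 2 + s * (b 0 - a 0) := by
  have hs := sum_sq_pos_of_ne hab
  have h2 : dist a y ^ 2 = dist b y ^ 2 := by rw [h]
  rw [dist_sq_eq, dist_sq_eq] at h2
  refine ⟨((b 0 - a 0) * (y 1 - a 1) - (b 1 - a 1) * (y 0 - a 0)) /
    ((b 0 - a 0) ^ 2 + (b 1 - a 1) ^ 2), ?_, ?_⟩
  · field_simp
    linear_combination (b 0 - a 0) * h2
  · field_simp
    linear_combination (b 1 - a 1) * h2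

/-- The power of `c` with respect to the circle through `a` and `b` centred at `y` is affine in the
parameter `s` of the centre. This turns the empty circle conditions below into linear inequalities.
-/
theorem dist_sq_sub_of_param {a b y : Plane} {s : ℝ}
    (h0 : y 0 = (a 0 + b 0) / 2 - s * (b 1 - a 1))
    (h1 : y 1 = (a 1 + b 1) / 2 + s * (b 0 - a 0)) (c : Plane) :
    dist c y ^ 2 - dist a y ^ 2 = dot a b c - 2 * (s * cross a b c) := by
  rw [dist_sq_eq, dist_sq_eq, h0, h1, dot, cross]
  ring

theorem dist_sq_of_param {a b y : Plane} {s : ℝ}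
    (h0 : y 0 = (a 0 + b 0) / 2 - s * (b 1 - a 1))
    (h1 : y 1 = (a 1 + b 1) / 2 + s * (b 0 - a 0)) :
    dist a y ^ 2 = dist a b ^ 2 * (1 / 4 + s ^ 2) := by
  rw [dist_sq_eq, dist_sq_eq, h0, h1]
  ring

theorem dist_sq_law (a b c : Plane) :
    dist a b ^ 2 = dist a c ^ 2 + dist b c ^ 2 - 2 * dot a b c := by
  rw [dist_sq_eq, dist_sq_eq, dist_sq_eq, dot]
  ring

theorem mem_hull_pair_of_dot_neg {a b p : Plane} (hcr : cross a b p = 0) (hdot : dot a b p < 0) :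
    p ∈ convexHull ℝ ({a, b} : Set Plane) := by
  have hab : a ≠ b := by
    rintro rfl
    unfold dot at hdot
    nlinarith [mul_self_nonneg (a 0 - p 0), mul_self_nonneg (a 1 - p 1)]
  have hs := sum_sq_pos_of_ne hab
  set N := (b 0 - a 0) ^ 2 + (b 1 - a 1) ^ 2 with hN
  set r := ((p 0 - a 0) * (b 0 - a 0) + (p 1 - a 1) * (b 1 - a 1)) / N with hr
  have hrN : r * N = (p 0 - a 0) * (b 0 - a 0) + (p 1 - a 1) * (b 1 - a 1) := by
    rw [hr]
    field_simp
  unfold cross at hcr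
  have e0 : p 0 = a 0 + r * (b 0 - a 0) := by
    apply mul_left_cancel₀ hs.ne'
    linear_combination -(b 0 - a 0) * hrN - (b 1 - a 1) * hcr + (p 0 - a 0) * hN
  have e1 : p 1 = a 1 + r * (b 1 - a 1) := by
    apply mul_left_cancel₀ hs.ne'
    linear_combination -(b 1 - a 1) * hrN + (b 0 - a 0) * hcr + (p 1 - a 1) * hN
  have hd : dot a b p = (r ^ 2 - r) * N := by
    rw [dot, e0, e1, hN]
    ring
  rw [hd] at hdot
  have hlt : r ^ 2 - r < 0 := by
    by_contra h
    have := mul_nonneg (not_lt.1 h) hs.le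
    linarith
  have hr0 : 0 < r := by nlinarith
  have hr1 : r < 1 := by nlinarith
  refine mem_convexHull_pair.2 ⟨1 - r, r, by linarith, hr0.le, by ring, ?_⟩
  apply plane_ext
  · simp only [PiLp.add_apply, PiLp.smul_apply, smul_eq_mul]
    rw [e0]
    ring
  · simp only [PiLp.add_apply, PiLp.smul_apply, smul_eq_mul]
    rw [e1]
    ring

/-- The triangle `t` has an obtuse angle opposite to its side `e`. -/
def ObtuseAt (t e : Finset Plane) : Prop :=
  ∃ a b c, a ≠ b ∧ c ≠ a ∧ c ≠ b ∧ e = {a, b} ∧ t = {a, b, c} ∧ dot a b c < 0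

theorem diam_pair_finset (a b : Plane) :
    Metric.diam ((({a, b} : Finset Plane)) : Set Plane) = dist a b := by
  push_cast
  exact Metric.diam_pair

/-- By the law of cosines. The strict inequality makes the obtuse side unique and later makes the
walk across obtuse sides terminate. -/
theorem ObtuseAt.diam_lt {t e e' : Finset Plane} (h : ObtuseAt t e) (he' : e'.card = 2)
    (hsub : e' ⊆ t) (hne : e' ≠ e) :
    Metric.diam (e' : Set Plane) < Metric.diam (e : Set Plane) := by
  obtain ⟨a, b, c, hab, hca, hcb, rfl, rfl, hd⟩ := h
  have hlaw := dist_sq_law a b c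
  have h1 : dist a c < dist a b := by
    apply lt_of_pow_lt_pow_left₀ 2 dist_nonneg
    nlinarith [sq_nonneg (dist b c)]
  have h2 : dist b c < dist a b := by
    apply lt_of_pow_lt_pow_left₀ 2 dist_nonneg
    nlinarith [sq_nonneg (dist a c)]
  obtain ⟨p, q, hpq, rfl⟩ := Finset.card_eq_two.1 he'
  have hp : p ∈ ({a, b, c} : Finset Plane) := hsub (by simp)
  have hq : q ∈ ({a, b, c} : Finset Plane) := hsub (by simp)
  rw [diam_pair_finset, diam_pair_finset]
  simp only [Finset.mem_insert, Finset.mem_singleton] at hp hq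
  rcases hp with rfl | rfl | rfl <;> rcases hq with rfl | rfl | rfl
  · exact absurd rfl hpq
  · exact absurd rfl hne
  · exact h1
  · exact absurd (Finset.pair_comm _ _) hne
  · exact absurd rfl hpq
  · exact h2
  · rw [dist_comm]
    exact h1
  · rw [dist_comm]
    exact h2
  · exact absurd rfl hpq

theorem ObtuseAt.card {t e : Finset Plane} (h : ObtuseAt t e) : e.card = 2 := by
  obtain ⟨a, b, c, hab, -, -, rfl, -⟩ := h
  exact Finset.card_pair hab

theorem ObtuseAt.subset {t e : Finset Plane} (h : ObtuseAt t e) : e ⊆ t := by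
  obtain ⟨a, b, c, -, -, -, rfl, rfl, -⟩ := h
  intro x
  simp only [Finset.mem_insert, Finset.mem_singleton]
  tauto

theorem ObtuseAt.unique {t e e' : Finset Plane} (h : ObtuseAt t e) (h' : ObtuseAt t e') :
    e = e' := by
  by_contra hne
  exact lt_asymm (h.diam_lt h'.card h'.subset (Ne.symm hne)) (h'.diam_lt h.card h.subset hne)

theorem ObtuseAt.not_acuteLarge {K : Geometry.SimplicialComplex ℝ Plane} {α : ℝ≥0}
    {t : {t : Finset Plane // t ∈ K.faces ∧ t.card = 3}} {e : Finset Plane}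
    (h : ObtuseAt t.1 e) : ¬ AcuteLarge K α (some t) := by
  rintro ⟨t', ht', s, hs, hacute, -⟩
  obtain rfl : t = t' := by simpa using ht'
  obtain ⟨a, b, c, hab, hca, hcb, rfl, htt, hd⟩ := h
  rw [coe_triple htt] at hs
  obtain ⟨i, rfl⟩ : a ∈ range s.points := by rw [hs]; simp
  obtain ⟨j, rfl⟩ : b ∈ range s.points := by rw [hs]; simp
  obtain ⟨k, rfl⟩ : c ∈ range s.points := by rw [hs]; simp
  have := hacute i k j (fun h => hca (by rw [h])) (fun h => hab (by rw [h]))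
    (fun h => hcb (by rw [h]))
  rw [angle_lt_pi_div_two_iff] at this
  exact lt_asymm hd this

/-! ### Empty circles and membership in the alpha-complex. -/

section Delaunay

variable {C : Finset Plane} {K : Geometry.SimplicialComplex ℝ Plane}

theorem IsDelaunay.mem_cloud (hK : IsDelaunay C K) {s : Finset Plane} (hs : s ∈ K.faces)
    {p : Plane} (hp : p ∈ s) : p ∈ C := by
  have : p ∈ K.vertices := by
    rw [Geometry.SimplicialComplex.vertices_eq]
    exact mem_iUnion₂.2 ⟨s, hs, hp⟩
  rw [hK.vertices_eq] at this
  exact this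

theorem IsDelaunay.finite_faces (hK : IsDelaunay C K) : K.faces.Finite :=
  (C.powerset.finite_toSet).subset fun _ hs =>
    Finset.mem_coe.2 (Finset.mem_powerset.2 fun _ hp => hK.mem_cloud hs hp)

theorem IsDelaunay.convex_space (hK : IsDelaunay C K) : Convex ℝ K.space := by
  rw [hK.space_eq]
  exact convex_convexHull _ _

theorem alphaComplex_subset (C : Finset Plane) (K : Geometry.SimplicialComplex ℝ Plane) (α : ℝ≥0) :
    (alphaComplex C K α).faces ⊆ K.faces := fun _ h => h.1

/-- A point witnesses itself, even for `α = 0`. -/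
theorem vertices_subset_alphaComplex (C : Finset Plane)
    (K : Geometry.SimplicialComplex ℝ Plane) (α : ℝ≥0) :
    K.vertices ⊆ (alphaComplex C K α).vertices := by
  intro p hp
  refine ⟨hp, p, ?_⟩
  simp [voronoiCell]

theorem alphaComplex_mono (C : Finset Plane) (K : Geometry.SimplicialComplex ℝ Plane) {α β : ℝ≥0}
    (h : β ≤ α) : (alphaComplex C K β).faces ⊆ (alphaComplex C K α).faces := by
  rintro σ ⟨h1, q, hq⟩
  refine ⟨h1, q, ?_⟩
  simp only [mem_iInter] at hq ⊢
  exact fun p hp => ⟨(hq p hp).1, Metric.closedBall_subset_closedBall (by exact_mod_cast h)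
    (hq p hp).2⟩

/-- The circumcenter of a Delaunay triangle and the emptiness of its circumcircle. -/
theorem IsDelaunay.exists_center (hK : IsDelaunay C K) {t : Finset Plane} (ht : t ∈ K.faces)
    {a : Plane} (ha : a ∈ t) :
    ∃ q, (∀ p ∈ t, dist p q = dist a q) ∧ (∀ p ∈ C, dist a q ≤ dist p q) ∧
      ∀ α : ℝ≥0, dist a q ≤ α → t ∈ (alphaComplex C K α).faces := by
  obtain ⟨q, hq⟩ := hK.nerve t ht
  simp only [mem_iInter] at hq
  have heq : ∀ p ∈ t, dist p q = dist a q := fun p hp =>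
    le_antisymm (hq p hp a (hK.mem_cloud ht ha)) (hq a ha p (hK.mem_cloud ht hp))
  refine ⟨q, heq, fun p hp => hq a ha p hp, fun α hα => ⟨ht, q, ?_⟩⟩
  simp only [mem_iInter]
  refine fun p hp => ⟨hq p hp, ?_⟩
  rw [Metric.mem_closedBall, dist_comm, heq p hp]
  exact hα

theorem exists_witness {α : ℝ≥0} {σ : Finset Plane} (hK : IsDelaunay C K)
    (h : σ ∈ (alphaComplex C K α).faces)
    {a : Plane} (ha : a ∈ σ) :
    ∃ y, (∀ p ∈ σ, dist p y = dist a y) ∧ (∀ p ∈ C, dist a y ≤ dist p y) ∧ dist a y ≤ α := by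
  obtain ⟨hσ, y, hy⟩ := h
  simp only [mem_iInter] at hy
  refine ⟨y, fun p hp => ?_, fun p hp => (hy a ha).1 p hp, ?_⟩
  · exact le_antisymm ((hy p hp).1 a (hK.mem_cloud hσ ha)) ((hy a ha).1 p (hK.mem_cloud hσ hp))
  · rw [dist_comm]
    exact (hy a ha).2

theorem not_mem_alphaComplex_of_long (hK : IsDelaunay C K) {α : ℝ≥0} {e : Finset Plane}
    (he : e.card = 2) (h : 2 * (α : ℝ) < Metric.diam (e : Set Plane)) :
    e ∉ (alphaComplex C K α).faces := by
  obtain ⟨a, b, hab, rfl⟩ := Finset.card_eq_two.1 he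
  rw [diam_pair_finset] at h
  intro hmem
  obtain ⟨y, h1, -, h3⟩ := exists_witness hK hmem (a := a) (by simp)
  have h4 := h1 b (by simp)
  have := dist_triangle_right a b y
  linarith

theorem not_mem_of_subset {α : ℝ≥0} {e t : Finset Plane} (he : e.Nonempty) (het : e ⊆ t)
    (h : e ∉ (alphaComplex C K α).faces) : t ∉ (alphaComplex C K α).faces :=
  fun ht => h ((alphaComplex C K α).down_closed ht het he)

/-- The circumcentre of `t` lies beyond `e`, away from `c`. An empty circle through `a` and `b` must
leave `c` outside or on it, so its centre is at least as far from `e` and its radius at least the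
circumradius. A witness for `e` would thus force `t` into the complex. -/
theorem ObtuseAt.not_mem_alphaComplex (hK : IsDelaunay C K) {α : ℝ≥0} {t e : Finset Plane}
    (ht : t ∈ K.faces) (hcard : t.card = 3) (h : ObtuseAt t e)
    (htα : t ∉ (alphaComplex C K α).faces) : e ∉ (alphaComplex C K α).faces := by
  obtain ⟨a, b, c, hab, hca, hcb, rfl, htt, hd⟩ := h
  have hD := cross_ne_zero_of_face ht hcard htt
  intro hmem
  obtain ⟨y, hy1, hy2, hy3⟩ := exists_witness hK hmem (a := a) (by simp)
  obtain ⟨q, hq1, hq2, hq3⟩ := hK.exists_center ht (a := a) (by simp [htt])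
  have hyb := hy1 b (by simp)
  have hqb := hq1 b (by simp [htt])
  have hqc := hq1 c (by simp [htt])
  obtain ⟨s, s0, s1⟩ := exists_bisector_param hab hyb.symm
  obtain ⟨r, r0, r1⟩ := exists_bisector_param hab hqb.symm
  have k1 := dist_sq_sub_of_param s0 s1 c
  have k2 := dist_sq_sub_of_param r0 r1 c
  have k3 := dist_sq_of_param s0 s1
  have k4 := dist_sq_of_param r0 r1
  have hyc : dist a y ^ 2 ≤ dist c y ^ 2 :=
    pow_le_pow_left₀ dist_nonneg (hy2 c (hK.mem_cloud ht (by simp [htt]))) 2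
  rw [hqc] at k2
  apply htα
  apply hq3
  refine le_trans ?_ hy3
  refine (sq_le_sq₀ dist_nonneg dist_nonneg).1 ?_
  rw [k3, k4]
  apply mul_le_mul_of_nonneg_left _ (sq_nonneg _)
  have hle : s * cross a b c ≤ r * cross a b c := by linarith
  have hneg : r * cross a b c < 0 := by linarith
  have hsq : (r * cross a b c) ^ 2 ≤ (s * cross a b c) ^ 2 := by nlinarith
  rw [mul_pow, mul_pow] at hsq
  have := le_of_mul_le_mul_right hsq (by positivity)
  linarith

/-- A short edge outside the alpha-complex lies opposite to an obtuse angle of a triangle. -/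
theorem exists_obtuseAt_of_short (hK : IsDelaunay C K) {α : ℝ≥0} {e : Finset Plane}
    (heK : e ∈ K.faces) (he : e.card = 2) (hα : e ∉ (alphaComplex C K α).faces)
    (hshort : Metric.diam (e : Set Plane) ≤ 2 * α) :
    ∃ t ∈ K.faces, t.card = 3 ∧ ObtuseAt t e := by
  obtain ⟨a, b, hab, rfl⟩ := Finset.card_eq_two.1 he
  rw [diam_pair_finset] at hshort
  set m : Plane := (1 / 2 : ℝ) • a + (1 / 2 : ℝ) • b with hm
  have m0 : m 0 = (a 0 + b 0) / 2 - 0 * (b 1 - a 1) := by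
    simp only [hm, PiLp.add_apply, PiLp.smul_apply, smul_eq_mul]
    ring
  have m1 : m 1 = (a 1 + b 1) / 2 + 0 * (b 0 - a 0) := by
    simp only [hm, PiLp.add_apply, PiLp.smul_apply, smul_eq_mul]
    ring
  have ham : dist a m = dist a b / 2 := by
    have := dist_sq_of_param m0 m1
    apply (sq_eq_sq₀ dist_nonneg (by positivity)).1
    rw [this]
    ring
  have hbm : dist b m = dist a m := by
    apply (sq_eq_sq₀ dist_nonneg dist_nonneg).1
    have := dist_sq_sub_of_param m0 m1 b
    have h0 : dot a b b = 0 := by simp [dot]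
    rw [h0] at this
    linarith
  -- Otherwise the circle with diameter `a b` is empty and its centre is a witness for the edge. A
  -- point `p` inside it sees `a b` under an obtuse angle.
  have hex : ∃ p ∈ C, dist p m < dist a m := by
    by_contra! hcon
    apply hα
    refine ⟨heK, m, ?_⟩
    simp only [mem_iInter]
    intro p hp
    have hpm : dist p m = dist a m := by
      simp only [Finset.mem_insert, Finset.mem_singleton] at hp
      rcases hp with rfl | rfl
      · rfl
      · exact hbm
    refine ⟨fun p' hp' => ?_, ?_⟩
    · rw [hpm]
      exact hcon p' hp'
    · rw [Metric.mem_closedBall, dist_comm, hpm, ham]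
      linarith
  obtain ⟨p, hpC, hp⟩ := hex
  have hdp : dot a b p < 0 := by
    have h1 := dist_sq_sub_of_param m0 m1 p
    have h2 : dist p m ^ 2 < dist a m ^ 2 := pow_lt_pow_left₀ hp dist_nonneg (by norm_num)
    linarith
  have hpV : p ∈ K.vertices := by
    rw [hK.vertices_eq]
    exact hpC
  have hcr : cross a b p ≠ 0 := by
    intro h0
    have hmem := mem_hull_pair_of_dot_neg h0 hdp
    have hpe : p ∈ ({a, b} : Finset Plane) :=
      (Geometry.SimplicialComplex.vertex_mem_convexHull_iff hpV heK).1 (by push_cast; exact hmem)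
    simp only [Finset.mem_insert, Finset.mem_singleton] at hpe
    rcases hpe with rfl | rfl <;> simp [dot] at hdp
  obtain ⟨t, ht, hcard, c, hca, hcb, htt, hpos⟩ := exists_triangle_on_side hK.finite_faces
    hK.convex_space hab heK (K.vertices_subset_space hpV) hcr
  refine ⟨t, ht, hcard, a, b, c, hab, hca, hcb, rfl, htt, ?_⟩
  -- As `p` is not inside the circumcircle, the obtuse angle at `p` forces the circumcentre to the
  -- other side of `a b` from `p`. The vertex `c` is on the side of `p`, so the angle at `c` is
  -- obtuse too.
  obtain ⟨q, hq1, hq2, -⟩ := hK.exists_center ht (a := a) (by simp [htt])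
  obtain ⟨r, r0, r1⟩ := exists_bisector_param hab (hq1 b (by simp [htt])).symm
  have k1 := dist_sq_sub_of_param r0 r1 c
  have k2 := dist_sq_sub_of_param r0 r1 p
  rw [hq1 c (by simp [htt])] at k1
  have k3 : dist a q ^ 2 ≤ dist p q ^ 2 := pow_le_pow_left₀ dist_nonneg (hq2 p hpC) 2
  have k4 : r * cross a b p < 0 := by linarith
  by_contra hcon
  have k5 : 0 ≤ r * cross a b c := by linarith
  have k6 := mul_nonneg k5 (neg_nonneg.2 k4.le)
  have hr : r ≠ 0 := by
    rintro rfl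
    simp at k4
  have k7 := mul_pos (mul_self_pos.2 hr) hpos
  nlinarith

/-- Two triangles cannot both be obtuse opposite to a common side. -/
theorem ObtuseAt.eq_of_common_side (hK : IsDelaunay C K) {t t' e : Finset Plane}
    (ht : t ∈ K.faces) (ht' : t' ∈ K.faces) (hcard : t.card = 3) (hcard' : t'.card = 3)
    (h : ObtuseAt t e) (h' : ObtuseAt t' e) : t = t' := by
  by_contra hne
  obtain ⟨a, b, c, hab, hca, hcb, rfl, htt, hd⟩ := h
  obtain ⟨c', -, -, htt'⟩ := exists_third_vertex hab h'.subset hcard'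
  have hd' : dot a b c' < 0 := by
    obtain ⟨a₁, b₁, c₁, hab₁, hca₁, hcb₁, he₁, ht₁, hd₁⟩ := h'
    have hc₁ : c₁ = c' := by
      have hc₁ : c₁ ∈ ({a, b, c'} : Finset Plane) := by rw [← htt', ht₁]; simp
      have hc₁' : c₁ ∉ ({a, b} : Finset Plane) := by
        rw [he₁]
        simp [hca₁, hcb₁]
      simp only [Finset.mem_insert, Finset.mem_singleton, not_or] at hc₁ hc₁'
      tauto
    subst hc₁
    have ha : a ∈ ({a₁, b₁} : Finset Plane) := by rw [← he₁]; simp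
    have hb : b ∈ ({a₁, b₁} : Finset Plane) := by rw [← he₁]; simp
    simp only [Finset.mem_insert, Finset.mem_singleton] at ha hb
    have hsymm : dot b₁ a₁ c₁ = dot a₁ b₁ c₁ := by unfold dot; ring
    rcases ha with rfl | rfl <;> rcases hb with rfl | rfl
    · exact absurd rfl hab
    · exact hd₁
    · rw [hsymm]
      exact hd₁
    · exact absurd rfl hab
  -- The obtuse angle at `c` puts the circumcentre of `t` on the side of `c'`; emptiness at `c'` and
  -- the obtuse angle there put it on the side of `c`.
  have hopp := opposite_sides ht ht' hcard hcard' htt htt' hne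
  obtain ⟨q, hq1, hq2, -⟩ := hK.exists_center ht (a := a) (by simp [htt])
  obtain ⟨r, r0, r1⟩ := exists_bisector_param hab (hq1 b (by simp [htt])).symm
  have k1 := dist_sq_sub_of_param r0 r1 c
  have k2 := dist_sq_sub_of_param r0 r1 c'
  rw [hq1 c (by simp [htt])] at k1
  have k3 : dist a q ^ 2 ≤ dist c' q ^ 2 :=
    pow_le_pow_left₀ dist_nonneg (hq2 c' (hK.mem_cloud ht' (by simp [htt']))) 2
  have k4 : r * cross a b c < 0 := by linarith
  have k5 : r * cross a b c' < 0 := by linarith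
  have k6 := mul_pos_of_neg_of_neg k4 k5
  have k7 := mul_nonpos_of_nonneg_of_nonpos (mul_self_nonneg r) hopp.le
  nlinarith

theorem affineSpan_triangle_eq_top (s : Affine.Triangle ℝ Plane) :
    affineSpan ℝ (range s.points) = ⊤ := by
  rw [s.independent.affineSpan_eq_top_iff_card_eq_finrank_add_one, finrank_euclideanSpace_fin]
  simp

theorem circumradius_eq {t : Finset Plane} (s : Affine.Triangle ℝ Plane)
    (hs : range s.points = (t : Set Plane)) {q a : Plane} (hq : ∀ p ∈ t, dist p q = dist a q) :
    s.circumradius = dist a q := by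
  refine (s.eq_circumradius_of_dist_eq (p := q) ?_ fun i => hq _ ?_).symm
  · rw [affineSpan_triangle_eq_top]
    exact AffineSubspace.mem_top _ _ _
  · rw [← Finset.mem_coe, ← hs]
    exact mem_range_self i

theorem AcuteLarge.not_mem_alphaComplex (hK : IsDelaunay C K) {α : ℝ≥0}
    {t : {t : Finset Plane // t ∈ K.faces ∧ t.card = 3}} (h : AcuteLarge K α (some t)) :
    t.1 ∉ (alphaComplex C K α).faces := by
  obtain ⟨t', ht', s, hs, -, hα⟩ := h
  obtain rfl : t = t' := by simpa using ht'
  intro hmem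
  obtain ⟨a, ha⟩ := K.nonempty_of_mem_faces t.2.1
  obtain ⟨y, hy1, -, hy3⟩ := exists_witness hK hmem ha
  rw [circumradius_eq s hs hy1] at hα
  linarith

/-- A triangle outside the alpha-complex with short sides that is not acute is obtuse. -/
theorem exists_obtuseAt_of_not_acuteLarge (hK : IsDelaunay C K) {α : ℝ≥0}
    {t : {t : Finset Plane // t ∈ K.faces ∧ t.card = 3}}
    (htα : t.1 ∉ (alphaComplex C K α).faces) (hacute : ¬ AcuteLarge K α (some t))
    (hshort : ∀ e : Finset Plane, e.card = 2 → e ⊆ t.1 → Metric.diam (e : Set Plane) ≤ 2 * α) :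
    ∃ e, ObtuseAt t.1 e := by
  obtain ⟨a, b, c, hab, hac, hbc, htt⟩ := Finset.card_eq_three.1 t.2.2
  have hrot : t.1 = {b, c, a} := by
    rw [htt]
    ext x
    simp only [Finset.mem_insert, Finset.mem_singleton]
    tauto
  have hrot' : t.1 = {c, a, b} := by
    rw [htt]
    ext x
    simp only [Finset.mem_insert, Finset.mem_singleton]
    tauto
  by_contra! hno
  have key : ∀ a b c : Plane, a ≠ b → c ≠ a → c ≠ b → t.1 = {a, b, c} → 0 < dot a b c := by
    intro a b c hab hca hcb htt
    by_contra hle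
    rcases (not_lt.1 hle).lt_or_eq with hlt | h0
    · exact hno {a, b} ⟨a, b, c, hab, hca, hcb, rfl, htt, hlt⟩
    -- A right angle: the circumcentre is the midpoint of a short hypotenuse, so the circumradius is
    -- at most `α` and the triangle would be in the complex.
    · obtain ⟨q, hq1, -, hq3⟩ := hK.exists_center t.2.1 (a := a) (by simp [htt])
      obtain ⟨r, r0, r1⟩ := exists_bisector_param hab (hq1 b (by simp [htt])).symm
      have k1 := dist_sq_sub_of_param r0 r1 c
      have k2 := dist_sq_of_param r0 r1
      rw [hq1 c (by simp [htt]), h0] at k1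
      have hr : r = 0 := by
        have : r * cross a b c = 0 := by linarith
        exact (mul_eq_zero.1 this).resolve_right (cross_ne_zero_of_face t.2.1 t.2.2 htt)
      have hs := hshort {a, b} (Finset.card_pair hab) (by rw [htt]; intro; simp; tauto)
      rw [diam_pair_finset] at hs
      apply htα
      apply hq3
      have : dist a q = dist a b / 2 := by
        apply (sq_eq_sq₀ dist_nonneg (by positivity)).1
        rw [k2, hr]
        ring
      linarith
  have hind := affineIndependent_triple_of_coe htt t.2.2 (K.indep t.2.1)
  let s : Affine.Triangle ℝ Plane := ⟨![a, b, c], hind⟩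
  have hs : range s.points = (t.1 : Set Plane) := by
    rw [coe_triple htt]
    ext x
    simp only [s, mem_range, Fin.exists_fin_succ, mem_insert_iff, mem_singleton_iff]
    simp [eq_comm]
  apply hacute
  refine ⟨t, rfl, s, hs, ?_, ?_⟩
  · rw [Affine.Triangle.acuteAngled_iff_angle_lt, angle_lt_pi_div_two_iff,
      angle_lt_pi_div_two_iff, angle_lt_pi_div_two_iff]
    have hsymm : ∀ p q r : Plane, dot p q r = dot q p r := fun p q r => by unfold dot; ring
    refine ⟨?_, ?_, ?_⟩
    · rw [hsymm]
      exact key c a b hac.symm hbc hab.symm hrot'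
    · rw [hsymm]
      exact key a b c hab hac.symm hbc.symm htt
    · rw [hsymm]
      exact key b c a hbc hab hac hrot
  · obtain ⟨q, hq1, -, hq3⟩ := hK.exists_center t.2.1 (a := a) (by simp [htt])
    rw [circumradius_eq s hs hq1]
    by_contra hle
    exact htα (hq3 α (not_lt.1 hle))

end Delaunay

/-! ### Components of the dual graph and of the complement of the alpha-complex -/

section Components

variable {C : Finset Plane} {K : Geometry.SimplicialComplex ℝ Plane} {α : ℝ≥0}

/-- The longest common side exceeds the bound if and only if some common side does. The maximum
exists because one of two distinct nodes is a triangle and has finitely many sides. -/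
theorem longAdj_iff {v w : Node K} :
    LongAdj K α v w ↔ v ≠ w ∧ ∃ e, IsSide K e v ∧ IsSide K e w ∧
      2 * (α : ℝ) < Metric.diam (e : Set Plane) := by
  constructor
  · rintro ⟨⟨hne, -⟩, d, ⟨⟨e, h1, h2, rfl⟩, -⟩, hd⟩
    exact ⟨hne, e, h1, h2, hd⟩
  · rintro ⟨hne, e, h1, h2, hd⟩
    have hfin : (commonLengths K v w).Finite := by
      have key : ∀ t : Finset Plane,
          {d | ∃ e : Finset Plane, e ⊆ t ∧ d = Metric.diam (e : Set Plane)}.Finite := by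
        intro t
        refine ((t.powerset.finite_toSet).image
          fun e : Finset Plane => Metric.diam (e : Set Plane)).subset ?_
        rintro d ⟨e, he, rfl⟩
        exact ⟨e, Finset.mem_coe.2 (Finset.mem_powerset.2 he), rfl⟩
      rcases v with _ | t
      · rcases w with _ | t
        · exact absurd rfl hne
        · exact (key t.1).subset fun d ⟨e, _, h, hd⟩ => ⟨e, h.2, hd⟩
      · exact (key t.1).subset fun d ⟨e, h, _, hd⟩ => ⟨e, h.2, hd⟩
    have hmem : Metric.diam (e : Set Plane) ∈ commonLengths K v w := ⟨e, h1, h2, rfl⟩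
    refine ⟨⟨hne, _, hmem⟩, sSup (commonLengths K v w),
      ⟨Set.Nonempty.csSup_mem ⟨_, hmem⟩ hfin, fun d hd => le_csSup hfin.bddAbove hd⟩,
      hd.trans_le (le_csSup hfin.bddAbove hmem)⟩

theorem LongAdj.link (hK : IsDelaunay C K) {v w : Node K} (h : LongAdj K α v w) :
    Link K (alphaComplex C K α) v w := by
  obtain ⟨-, e, h1, h2, h3⟩ := longAdj_iff.1 h
  exact ⟨e, not_mem_alphaComplex_of_long hK h1.card h3, h1, h2⟩

theorem edge_nonempty {e : Finset Plane} (h : e.card = 2) : e.Nonempty := by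
  rw [← Finset.card_pos, h]
  norm_num

theorem not_mem_of_mem_verts (hK : IsDelaunay C K)
    {t : {t : Finset Plane // t ∈ K.faces ∧ t.card = 3}}
    (h : some t ∈ (alphaGraph K α).verts) : t.1 ∉ (alphaComplex C K α).faces := by
  rcases h with h | ⟨w, h⟩ | h
  · simp at h
  · obtain ⟨e, h1, h2, -⟩ := h.link hK
    exact not_mem_of_subset (edge_nonempty h2.card) h2.2 h1
  · exact h.not_mem_alphaComplex hK

theorem mem_verts_mono {β : ℝ≥0} (h : β ≤ α) {v : Node K} (hv : v ∈ (alphaGraph K α).verts) :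
    v ∈ (alphaGraph K β).verts := by
  have hR : (β : ℝ) ≤ α := by exact_mod_cast h
  rcases hv with h1 | ⟨w, h1⟩ | ⟨t, h1, s, h2, h3, h4⟩
  · exact Or.inl h1
  · obtain ⟨hne, e, h2, h3, h4⟩ := longAdj_iff.1 h1
    exact Or.inr (Or.inl ⟨w, longAdj_iff.2 ⟨hne, e, h2, h3, by linarith⟩⟩)
  · exact Or.inr (Or.inr ⟨t, h1, s, h2, h3, by linarith⟩)

/-- The component of the graph `C*(α)` to which a node is attached: a node that is not in the graph
is passed on across the side opposite to the obtuse angle of its triangle. -/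
inductive Attached (C : Finset Plane) (K : Geometry.SimplicialComplex ℝ Plane) (α : ℝ≥0) :
    Node K → (alphaGraph K α).coe.ConnectedComponent → Prop
  | kept (v : Node K) (h : v ∈ (alphaGraph K α).verts) :
      Attached C K α v ((alphaGraph K α).coe.connectedComponentMk ⟨v, h⟩)
  | across (t : {t : Finset Plane // t ∈ K.faces ∧ t.card = 3}) (e : Finset Plane) (w : Node K)
      (c : (alphaGraph K α).coe.ConnectedComponent) (h : some t ∉ (alphaGraph K α).verts)
      (he : ObtuseAt t.1 e) (heα : e ∉ (alphaComplex C K α).faces) (hne : w ≠ some t)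
      (hw : IsSide K e w) (hc : Attached C K α w c) : Attached C K α (some t) c

theorem Attached.eq_mk {v : Node K} {c : (alphaGraph K α).coe.ConnectedComponent}
    (h : Attached C K α v c) (hv : v ∈ (alphaGraph K α).verts) :
    c = (alphaGraph K α).coe.connectedComponentMk ⟨v, hv⟩ := by
  cases h with
  | kept _ _ => rfl
  | across t e w _ h _ _ _ _ _ => exact absurd hv h

/-- The passing rule is deterministic: a triangle has at most one obtuse side, and there is only one
node on its other side. -/
theorem Attached.unique {v : Node K} {c c' : (alphaGraph K α).coe.ConnectedComponent}
    (h : Attached C K α v c) (h' : Attached C K α v c') : c = c' := by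
  induction h generalizing c' with
  | kept v hv => exact (h'.eq_mk hv).symm
  | across t e w c hnot he heα hne hw hc ih =>
    cases h' with
    | kept _ hv => exact absurd hv hnot
    | across _ e' w' _ _ he' _ hne' hw' hc' =>
      obtain rfl := he.unique he'
      have hside : IsSide K e (some t) := ⟨he.card, he.subset⟩
      rcases hside.eq_or_eq hw hw' hne.symm with rfl | rfl
      · exact absurd rfl hne'
      · exact ih hc'

theorem exists_obtuseAt_of_not_mem_verts (hK : IsDelaunay C K)
    {t : {t : Finset Plane // t ∈ K.faces ∧ t.card = 3}}
    (htα : t.1 ∉ (alphaComplex C K α).faces) (h : some t ∉ (alphaGraph K α).verts) :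
    ∃ e, ObtuseAt t.1 e := by
  refine exists_obtuseAt_of_not_acuteLarge hK htα (fun h' => h (Or.inr (Or.inr h'))) ?_
  intro e he hsub
  by_contra hlt
  obtain ⟨w, hne, hw⟩ := exists_other_side he t.2.1 t.2.2 hsub
  exact h (Or.inr (Or.inl ⟨w, longAdj_iff.2 ⟨hne.symm, e, ⟨he, hsub⟩, hw, not_le.1 hlt⟩⟩))

/-- The walk across obtuse sides ends because the obtuse sides get strictly longer and there are
finitely many triangles. -/
theorem exists_attached_triangle (hK : IsDelaunay C K)
    (t : {t : Finset Plane // t ∈ K.faces ∧ t.card = 3})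
    (htα : t.1 ∉ (alphaComplex C K α).faces) : ∃ c, Attached C K α (some t) c := by
  classical
  have hfin : Finite {t : Finset Plane // t ∈ K.faces ∧ t.card = 3} :=
    (hK.finite_faces.subset fun t (ht : t ∈ K.faces ∧ t.card = 3) => ht.1).to_subtype
  -- The value 0 is irrelevant: only lengths of obtuse triangles are compared.
  let len : {t : Finset Plane // t ∈ K.faces ∧ t.card = 3} → ℝ := fun t =>
    if h : ∃ e, ObtuseAt t.1 e then Metric.diam (h.choose : Set Plane) else 0
  have hlen : ∀ t e, ObtuseAt t.1 e → len t = Metric.diam (e : Set Plane) := by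
    intro t e he
    have h : ∃ e, ObtuseAt t.1 e := ⟨e, he⟩
    simp only [len, dif_pos h]
    rw [h.choose_spec.unique he]
  have hwf : WellFounded fun t' t => len t < len t' :=
    @Finite.wellFounded_of_trans_of_irrefl _ hfin _ ⟨fun _ _ _ h1 h2 => h2.trans h1⟩
      ⟨fun _ => lt_irrefl _⟩
  induction t using hwf.induction with
  | _ t ih =>
    by_cases hv : some t ∈ (alphaGraph K α).verts
    · exact ⟨_, Attached.kept _ hv⟩
    obtain ⟨e, he⟩ := exists_obtuseAt_of_not_mem_verts hK htα hv
    have heα := he.not_mem_alphaComplex hK t.2.1 t.2.2 htα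
    obtain ⟨w, hne, hw⟩ := exists_other_side he.card t.2.1 t.2.2 he.subset
    suffices ∃ c, Attached C K α w c by
      obtain ⟨c, hc⟩ := this
      exact ⟨c, Attached.across t e w c hv he heα hne hw hc⟩
    by_cases hwv : w ∈ (alphaGraph K α).verts
    · exact ⟨_, Attached.kept _ hwv⟩
    rcases w with _ | t'
    · exact absurd (Or.inl rfl) hwv
    have htα' := not_mem_of_subset (edge_nonempty he.card) hw.2 heα
    refine ih t' ?_ htα'
    obtain ⟨e', he'⟩ := exists_obtuseAt_of_not_mem_verts hK htα' hwv
    rw [hlen t e he, hlen t' e' he']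
    -- The side `e` just crossed is not the obtuse side `e'` of `t'`, since two triangles are not
    -- both obtuse opposite to a common side; so `e` is shorter than `e'`.
    refine he'.diam_lt he.card hw.2 ?_
    rintro rfl
    exact hne (congrArg some (Subtype.ext
      (he.eq_of_common_side hK t.2.1 t'.2.1 t.2.2 t'.2.2 he').symm))

theorem exists_attached_of_side (hK : IsDelaunay C K) {e : Finset Plane} {v : Node K}
    (hα : e ∉ (alphaComplex C K α).faces) (hv : IsSide K e v) : ∃ c, Attached C K α v c := by
  cases v with
  | none => exact ⟨_, Attached.kept none (Or.inl rfl)⟩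
  | some t =>
    exact exists_attached_triangle hK t (not_mem_of_subset (edge_nonempty hv.card) hv.2 hα)

/-- The longest side `e` of `t` is short, so `t` has no neighbour in C*(α); being obtuse, it is
dropped from the graph and passed on to `w`. -/
theorem Attached.eq_of_obtuse
    {t : {t : Finset Plane // t ∈ K.faces ∧ t.card = 3}} {w : Node K} {e : Finset Plane}
    (he : ObtuseAt t.1 e) (hα : e ∉ (alphaComplex C K α).faces)
    (hshort : Metric.diam (e : Set Plane) ≤ 2 * α) (hne : w ≠ some t) (hw : IsSide K e w)
    {c c' : (alphaGraph K α).coe.ConnectedComponent}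
    (hc : Attached C K α (some t) c) (hc' : Attached C K α w c') : c = c' := by
  refine hc.unique (Attached.across t e w c' ?_ he hα hne hw hc')
  rintro (h | ⟨w', h⟩ | h)
  · simp at h
  · obtain ⟨-, e', h1, -, h3⟩ := longAdj_iff.1 h
    by_cases hee : e' = e
    · rw [hee] at h3
      linarith
    · have := he.diam_lt h1.card h1.2 hee
      linarith
  · exact he.not_acuteLarge h

/-- Nodes with a common side outside the alpha-complex are attached to the same component. -/
theorem Attached.eq_of_link (hK : IsDelaunay C K) {v w : Node K}
    (hl : Link K (alphaComplex C K α) v w) {c c' : (alphaGraph K α).coe.ConnectedComponent}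
    (hc : Attached C K α v c) (hc' : Attached C K α w c') : c = c' := by
  obtain ⟨e, hα, hv, hw⟩ := hl
  by_cases hvw : v = w
  · subst hvw
    exact hc.unique hc'
  rcases lt_or_ge (2 * (α : ℝ)) (Metric.diam (e : Set Plane)) with hlong | hshort
  · have hadj : LongAdj K α v w := longAdj_iff.2 ⟨hvw, e, hv, hw, hlong⟩
    have hv' : v ∈ (alphaGraph K α).verts := (alphaGraph K α).edge_vert hadj
    have hw' : w ∈ (alphaGraph K α).verts :=
      (alphaGraph K α).edge_vert ((alphaGraph K α).symm.symm _ _ hadj)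
    rw [hc.eq_mk hv', hc'.eq_mk hw']
    apply SimpleGraph.ConnectedComponent.sound
    apply SimpleGraph.Adj.reachable
    exact hadj
  · obtain ⟨t, ht, hcard, he⟩ := exists_obtuseAt_of_short hK hv.mem_faces hv.card hα hshort
    have hside : IsSide K e (some ⟨t, ht, hcard⟩) := ⟨hv.card, he.subset⟩
    rcases hv.eq_or_eq hw hside hvw with rfl | rfl
    · exact Attached.eq_of_obtuse he hα hshort (Ne.symm hvw) hw hc hc'
    · exact (Attached.eq_of_obtuse he hα hshort hvw hv hc' hc).symm

/-- The component to which a node is attached (arbitrary for triangles of the alpha-complex). -/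
def attach (C : Finset Plane) (K : Geometry.SimplicialComplex ℝ Plane) (α : ℝ≥0) (v : Node K) :
    (alphaGraph K α).coe.ConnectedComponent :=
  open Classical in
  if h : ∃ c, Attached C K α v c then h.choose
  else (alphaGraph K α).coe.connectedComponentMk ⟨none, Or.inl rfl⟩

theorem Attached.attach_eq {v : Node K} {c : (alphaGraph K α).coe.ConnectedComponent}
    (h : Attached C K α v c) : attach C K α v = c := by
  have h' : ∃ c, Attached C K α v c := ⟨c, h⟩
  rw [attach, dif_pos h']
  exact h'.choose_spec.unique h

theorem attach_of_mem {v : Node K} (hv : v ∈ (alphaGraph K α).verts) :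
    attach C K α v = (alphaGraph K α).coe.connectedComponentMk ⟨v, hv⟩ :=
  (Attached.kept v hv).attach_eq

theorem attach_eq_of_link (hK : IsDelaunay C K) {v w : Node K}
    (h : Link K (alphaComplex C K α) v w) : attach C K α v = attach C K α w := by
  obtain ⟨e, hα, hv, hw⟩ := id h
  obtain ⟨c, hc⟩ := exists_attached_of_side hK hα hv
  obtain ⟨c', hc'⟩ := exists_attached_of_side hK hα hw
  rw [hc.attach_eq, hc'.attach_eq]
  exact hc.eq_of_link hK h hc'

/-- Both regions are near the midpoint of the missing side, so they lie in the same component of the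
complement. -/
theorem region_subset_iff_of_link (hK : IsDelaunay C K) {v w : Node K}
    (h : Link K (alphaComplex C K α) v w) (x : Plane) :
    region K v ⊆ connectedComponentIn (alphaComplex C K α).spaceᶜ x ↔
      region K w ⊆ connectedComponentIn (alphaComplex C K α).spaceᶜ x := by
  have hS := alphaComplex_subset C K α
  obtain ⟨e, hα, hv, hw⟩ := h
  obtain ⟨y, hy, hnear⟩ := exists_near_of_side hK.finite_faces hK.convex_space hS hv.mem_faces
    hv.card hα
  have key : ∀ u u' : Node K, Near K y u → Near K y u' →
      region K u ⊆ connectedComponentIn (alphaComplex C K α).spaceᶜ x →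
      region K u' ⊆ connectedComponentIn (alphaComplex C K α).spaceᶜ x := by
    intro u u' hu hu' hsub
    have h1 := region_subset_component hK.finite_faces hK.convex_space hS hy hu
    have h2 := region_subset_component hK.finite_faces hK.convex_space hS hy hu'
    obtain ⟨z, hz⟩ := region_nonempty hK.finite_faces u
    rw [connectedComponentIn_eq (h1 hz)] at h2
    rwa [connectedComponentIn_eq (hsub hz)]
  exact ⟨key v w (hnear v hv) (hnear w hw), key w v (hnear w hw) (hnear v hv)⟩

/-- Each passage across an obtuse side and each edge of a walk in C*(α) is a link. -/
theorem region_subset_iff_of_attached (hK : IsDelaunay C K) {v : Node K}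
    {c : (alphaGraph K α).coe.ConnectedComponent} (h : Attached C K α v c)
    (u : (alphaGraph K α).verts) (hu : u ∈ c.supp) (x : Plane) :
    region K v ⊆ connectedComponentIn (alphaComplex C K α).spaceᶜ x ↔
      region K u.1 ⊆ connectedComponentIn (alphaComplex C K α).spaceᶜ x := by
  induction h with
  | kept v hv =>
    have hr : (alphaGraph K α).coe.Reachable u ⟨v, hv⟩ :=
      SimpleGraph.ConnectedComponent.exact hu
    obtain ⟨p⟩ := hr.symm
    clear hu
    generalize hv0 : (⟨v, hv⟩ : (alphaGraph K α).verts) = v0 at p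
    have hv1 : v = v0.1 := by rw [← hv0]
    rw [hv1]
    clear hv0 hv1 hr
    induction p with
    | nil => exact Iff.rfl
    | cons hadj _ ih =>
      have hl : LongAdj K α _ _ := hadj
      exact (region_subset_iff_of_link hK (hl.link hK) x).trans ih
  | across t e w c hnot he heα hne hw hc ih =>
    exact (region_subset_iff_of_link hK (v := some t) ⟨e, heα, ⟨he.card, he.subset⟩, hw⟩ x).trans
      (ih hu)

end Components

/-! ### Holes, contours and white components -/

section Holes

variable {C : Finset Plane} {K : Geometry.SimplicialComplex ℝ Plane} {α : ℝ≥0}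

theorem IsHole.eq {S : Geometry.SimplicialComplex ℝ Plane} {R R' : Set Plane} (h : IsHole S R)
    (h' : IsHole S R') {z : Plane} (hz : z ∈ R) (hz' : z ∈ R') : R = R' := by
  obtain ⟨⟨x, -, rfl⟩, -⟩ := h
  obtain ⟨⟨x', -, rfl⟩, -⟩ := h'
  rw [connectedComponentIn_eq hz, connectedComponentIn_eq hz']

theorem WhiteComponent.none_not_mem_nodes (c : WhiteComponent K α) : none ∉ c.nodes := by
  rintro ⟨u, hu, hu'⟩
  apply c.2
  convert hu
  exact Subtype.ext hu'.symm

theorem WhiteComponent.exists_triangle (c : WhiteComponent K α) :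
    ∃ t, some t ∈ c.nodes := by
  obtain ⟨u, hu⟩ := c.1.nonempty_supp
  have hmem : u.1 ∈ c.nodes := ⟨u, hu, rfl⟩
  rcases hu' : u.1 with _ | t
  · rw [hu'] at hmem
    exact absurd hmem c.none_not_mem_nodes
  · exact ⟨t, hu' ▸ hmem⟩

theorem WhiteComponent.mem_nodes_iff {c : WhiteComponent K α} {v : Node K} :
    v ∈ c.nodes ↔ ∃ h : v ∈ (alphaGraph K α).verts,
      (alphaGraph K α).coe.connectedComponentMk ⟨v, h⟩ = c.1 := by
  constructor
  · rintro ⟨u, hu, rfl⟩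
    exact ⟨u.2, hu⟩
  · rintro ⟨h, hc⟩
    exact ⟨⟨v, h⟩, hc, rfl⟩

theorem WhiteComponent.eq_of_common_node {c c' : WhiteComponent K α} {v : Node K}
    (h : v ∈ c.nodes) (h' : v ∈ c'.nodes) : c = c' := by
  obtain ⟨_, h1⟩ := WhiteComponent.mem_nodes_iff.1 h
  obtain ⟨_, h2⟩ := WhiteComponent.mem_nodes_iff.1 h'
  exact Subtype.ext (h1.symm.trans h2)

/-- The triangles of the white component `c` lie in `R`. -/
def Fills (c : WhiteComponent K α) (R : Set Plane) : Prop :=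
  ∀ t, some t ∈ c.nodes → openTriangle t.1 ⊆ R

/-- Take the component to which a triangle of the hole is attached. If it contained v₀, the
unbounded external region would lie in the hole. -/
theorem exists_fills_of_isHole (hK : IsDelaunay C K) {R : Set Plane}
    (hR : IsHole (alphaComplex C K α) R) : ∃ c : WhiteComponent K α, Fills c R := by
  obtain ⟨⟨x, hx, rfl⟩, hb⟩ := hR
  obtain ⟨v, hv⟩ := exists_near hK.finite_faces x
  have hsub := region_subset_component hK.finite_faces hK.convex_space
    (alphaComplex_subset C K α) hx hv
  rcases v with _ | t
  · exact absurd hb (not_isBounded_of_external_subset hK.finite_faces hsub)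
  have htα : t.1 ∉ (alphaComplex C K α).faces := fun h =>
    hx ((alphaComplex C K α).convexHull_subset_space h hv)
  obtain ⟨c, hc⟩ := exists_attached_triangle hK t htα
  refine ⟨⟨c, fun h => ?_⟩, ?_⟩
  · exact not_isBounded_of_external_subset hK.finite_faces
      ((region_subset_iff_of_attached hK hc _ h x).1 hsub) hb
  · rintro t' ⟨u, hu, hu'⟩
    have := (region_subset_iff_of_attached hK hc u hu x).1 hsub
    rw [hu'] at this
    exact this

/-- The region around a triangle of `c` stays inside the triangulated hull: `attach` is constant on
it, and at a point outside the hull its value would be the component of v₀. -/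
theorem exists_isHole_of_white (hK : IsDelaunay C K) (c : WhiteComponent K α) :
    ∃ R, IsHole (alphaComplex C K α) R ∧ Fills c R := by
  obtain ⟨t, ht⟩ := c.exists_triangle
  obtain ⟨hv, hc⟩ := WhiteComponent.mem_nodes_iff.1 ht
  obtain ⟨x, hx⟩ := openTriangle_nonempty t.2.1 t.2.2
  have hxW := openTriangle_subset_compl (alphaComplex_subset C K α) t.2.1 t.2.2
    (not_mem_of_mem_verts hK hv) hx
  have hnear : Near K x (some t) := near_of_mem_region (v := some t) hx
  have hsub := region_subset_component hK.finite_faces hK.convex_space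
    (alphaComplex_subset C K α) hxW hnear
  have hatt : Attached C K α (some t) c.1 := hc ▸ Attached.kept _ hv
  refine ⟨_, ⟨⟨x, hxW, rfl⟩, ?_⟩, ?_⟩
  · refine (isCompact_space hK.finite_faces).isBounded.subset fun z hz => ?_
    by_contra hzK
    have := eq_of_near_component hK.finite_faces (vertices_subset_alphaComplex C K α)
      (attach C K α) (fun v w h => attach_eq_of_link hK h) (mem_connectedComponentIn hxW) hz
      hnear (near_of_mem_region (v := none) hzK)
    rw [hatt.attach_eq, attach_of_mem (Or.inl rfl)] at this
    exact c.2 this.symm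
  · rintro t' ⟨u, hu, hu'⟩
    have := (region_subset_iff_of_attached hK hatt u hu x).1 hsub
    rw [hu'] at this
    exact this

/-- Constancy of `attach` on the hole: all graph vertices whose triangles lie in `R` are in one
component. -/
theorem Fills.mem_nodes (hK : IsDelaunay C K) {R : Set Plane}
    (hR : IsHole (alphaComplex C K α) R) {c : WhiteComponent K α} (hc : Fills c R)
    {t : {t : Finset Plane // t ∈ K.faces ∧ t.card = 3}}
    (ht : some t ∈ (alphaGraph K α).verts) (hsub : openTriangle t.1 ⊆ R) :
    some t ∈ c.nodes := by
  obtain ⟨t', ht'⟩ := c.exists_triangle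
  obtain ⟨hv', hc'⟩ := WhiteComponent.mem_nodes_iff.1 ht'
  obtain ⟨y, hy⟩ := openTriangle_nonempty t.2.1 t.2.2
  obtain ⟨y', hy'⟩ := openTriangle_nonempty t'.2.1 t'.2.2
  have hsub' := hc t' ht'
  obtain ⟨⟨x, hx, rfl⟩, -⟩ := hR
  have := eq_of_near_component hK.finite_faces (vertices_subset_alphaComplex C K α)
    (attach C K α) (fun v w h => attach_eq_of_link hK h) (hsub hy) (hsub' hy')
    (near_of_mem_region (v := some t) hy) (near_of_mem_region (v := some t') hy')
  rw [attach_of_mem ht, attach_of_mem hv', hc'] at this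
  exact WhiteComponent.mem_nodes_iff.2 ⟨ht, this⟩

theorem Fills.unique (hK : IsDelaunay C K) {R : Set Plane}
    (hR : IsHole (alphaComplex C K α) R) {c c' : WhiteComponent K α} (hc : Fills c R)
    (hc' : Fills c' R) : c = c' := by
  obtain ⟨t, ht⟩ := c.exists_triangle
  obtain ⟨hv, -⟩ := WhiteComponent.mem_nodes_iff.1 ht
  exact WhiteComponent.eq_of_common_node ht (hc'.mem_nodes hK hR hv (hc t ht))

theorem Fills.hole_unique {R R' : Set Plane}
    (hR : IsHole (alphaComplex C K α) R) (hR' : IsHole (alphaComplex C K α) R')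
    {c : WhiteComponent K α} (hc : Fills c R) (hc' : Fills c R') : R = R' := by
  obtain ⟨t, ht⟩ := c.exists_triangle
  obtain ⟨y, hy⟩ := openTriangle_nonempty t.2.1 t.2.2
  exact hR.eq hR' (hc t ht hy) (hc' t ht hy)

/-! ### Boundary cycles of holes. -/

theorem card_sides_at_vertex {E : Finset (Finset Plane)} {t : Finset Plane} (ht : t.card = 3)
    {p : Plane} (hp : p ∈ t) (hE : ∀ e, e ⊆ t → e.card = 2 → p ∈ e → e ∈ E)
    (hE' : ∀ e ∈ E, e.card = 2 ∧ p ∈ e) : (E.filter (· ⊆ t)).card = 2 := by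
  have : E.filter (· ⊆ t) = (t.erase p).image fun q => ({p, q} : Finset Plane) := by
    ext e
    simp only [Finset.mem_filter, Finset.mem_image, Finset.mem_erase]
    constructor
    · rintro ⟨he, het⟩
      obtain ⟨h2, hpe⟩ := hE' e he
      have h1 : (e.erase p).card = 1 := by rw [Finset.card_erase_of_mem hpe, h2]
      obtain ⟨q, hq⟩ := Finset.card_eq_one.1 h1
      have hq' : q ∈ e.erase p := by simp [hq]
      refine ⟨q, ⟨(Finset.mem_erase.1 hq').1, het (Finset.mem_erase.1 hq').2⟩, ?_⟩
      rw [← Finset.insert_erase hpe, hq]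
    · rintro ⟨q, ⟨hqp, hqt⟩, rfl⟩
      have hsub : ({p, q} : Finset Plane) ⊆ t := by
        intro x hx
        simp only [Finset.mem_insert, Finset.mem_singleton] at hx
        rcases hx with rfl | rfl <;> assumption
      exact ⟨hE _ hsub (Finset.card_pair hqp.symm) (by simp), hsub⟩
  rw [this, Finset.card_image_of_injOn, Finset.card_erase_of_mem hp, ht]
  intro q hq q' hq' hqq
  have h : q ∈ ({p, q'} : Finset Plane) := by
    have : q ∈ ({p, q} : Finset Plane) := by simp
    rwa [show ({p, q} : Finset Plane) = {p, q'} from hqq] at this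
  simp only [Finset.mem_insert, Finset.mem_singleton] at h
  exact h.resolve_left (Finset.mem_erase.1 hq).1

/-- The boundary of a set of triangles has an even number of edges at every vertex. -/
theorem even_boundary_edges {T : Finset (Finset Plane)}
    (hT : ∀ t ∈ T, t ∈ K.faces ∧ t.card = 3) {γ : Finset (Finset Plane)}
    (hγ : ∀ e, e ∈ γ ↔ e.card = 2 ∧ ∃! t, t ∈ T ∧ e ⊆ t) (p : Plane) :
    Even {e | e ∈ γ ∧ p ∈ e}.ncard := by
  classical
  set E : Finset (Finset Plane) :=
    (T.biUnion Finset.powerset).filter fun e => e.card = 2 ∧ p ∈ e with hEdef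
  have hE' : ∀ e ∈ E, e.card = 2 ∧ p ∈ e := fun e he => (Finset.mem_filter.1 he).2
  -- Double counting of the pairs of an edge at `p` and a triangle of `T` containing it. Each
  -- triangle contributes two or none, so an even number of edges are in an odd number of triangles;
  -- odd means one, because an edge is in at most two.
  have hsum : Even (∑ e ∈ E, (T.filter (e ⊆ ·)).card) := by
    have hdc := Finset.sum_card_bipartiteAbove_eq_sum_card_bipartiteBelow
      (s := E) (t := T) (fun e t => e ⊆ t)
    simp only [Finset.bipartiteAbove, Finset.bipartiteBelow] at hdc
    rw [hdc]
    refine Finset.even_sum _ fun t ht => ?_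
    by_cases hp : p ∈ t
    · rw [card_sides_at_vertex (hT t ht).2 hp (fun e het h2 hpe => Finset.mem_filter.2
        ⟨Finset.mem_biUnion.2 ⟨t, ht, Finset.mem_powerset.2 het⟩, h2, hpe⟩) hE']
      exact even_two
    · rw [Finset.card_eq_zero.2]
      · exact Even.zero
      · rw [Finset.filter_eq_empty_iff]
        exact fun e he het => hp (het (hE' e he).2)
  rw [Finset.even_sum_iff_even_card_odd] at hsum
  convert hsum
  rw [← Set.ncard_coe_finset]
  congr 1
  ext e
  have hone : ∀ e : Finset Plane, (∃! t, t ∈ T ∧ e ⊆ t) ↔ (T.filter (e ⊆ ·)).card = 1 := by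
    intro e
    rw [Finset.card_eq_one]
    constructor
    · rintro ⟨t, ht, hu⟩
      refine ⟨t, Finset.ext fun s => ?_⟩
      simp only [Finset.mem_filter, Finset.mem_singleton]
      exact ⟨fun hs => hu s hs, fun hs => hs ▸ ht⟩
    · rintro ⟨t, ht⟩
      have hiff : ∀ s, (s ∈ T ∧ e ⊆ s) ↔ s = t := fun s => by
        rw [← Finset.mem_filter, ht, Finset.mem_singleton]
      exact ⟨t, (hiff t).2 rfl, fun s hs => (hiff s).1 hs⟩
  have hle : e.card = 2 → (T.filter (e ⊆ ·)).card ≤ 2 := by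
    intro h2
    by_contra! h3
    obtain ⟨t₁, h₁, t₂, h₂, t₃, h₃, h12, h13, h23⟩ := Finset.two_lt_card.1 h3
    rw [Finset.mem_filter] at h₁ h₂ h₃
    rcases eq_or_eq_of_common_side h2 ⟨(hT _ h₁.1).1, (hT _ h₁.1).2, h₁.2⟩
      ⟨(hT _ h₂.1).1, (hT _ h₂.1).2, h₂.2⟩ ⟨(hT _ h₃.1).1, (hT _ h₃.1).2, h₃.2⟩ h12 with h | h
    · exact h13 h.symm
    · exact h23 h.symm
  simp only [Set.mem_ofPred_eq, Finset.coe_filter, hγ, hone]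
  constructor
  · rintro ⟨⟨h2, h1⟩, hp⟩
    have : (T.filter (e ⊆ ·)).Nonempty := by
      rw [← Finset.card_pos, h1]
      norm_num
    obtain ⟨t, ht⟩ := this
    rw [Finset.mem_filter] at ht
    refine ⟨Finset.mem_filter.2 ⟨Finset.mem_biUnion.2 ⟨t, ht.1, Finset.mem_powerset.2 ht.2⟩,
      h2, hp⟩, ?_⟩
    rw [h1]
    exact odd_one
  · rintro ⟨he, hodd⟩
    obtain ⟨h2, hp⟩ := hE' e he
    refine ⟨⟨h2, ?_⟩, hp⟩
    have := hle h2
    obtain ⟨k, hk⟩ := hodd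
    omega

theorem exists_contour_of_isHole (hK : IsDelaunay C K) {R : Set Plane}
    (hR : IsHole (alphaComplex C K α) R) :
    ∃ γ, IsCycle (alphaComplex C K α) γ ∧ Bounds K γ R := by
  classical
  set T : Set (Finset Plane) := {t | t ∈ K.faces ∧ t.card = 3 ∧ openTriangle t ⊆ R} with hTdef
  have hTfin : T.Finite := hK.finite_faces.subset fun t ht => ht.1
  have hTT : ∀ t ∈ T, t ∈ K.faces ∧ t.card = 3 := fun t ht => ⟨ht.1, ht.2.1⟩
  have hmemT : ∀ e : Finset Plane, (∃! t, t ∈ T ∧ e ⊆ t) ↔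
      ∃! t : Finset Plane, t ∈ K.faces ∧ t.card = 3 ∧ e ⊆ t ∧ openTriangle t ⊆ R := by
    intro e
    apply existsUnique_congr
    intro t
    simp only [hTdef, Set.mem_ofPred_eq]
    tauto
  set γ : Finset (Finset Plane) :=
    hK.finite_faces.toFinset.filter fun e => e.card = 2 ∧ ∃! t, t ∈ T ∧ e ⊆ t with hγdef
  have hγ : ∀ e, e ∈ γ ↔ e ∈ K.faces ∧ e.card = 2 ∧ ∃! t, t ∈ T ∧ e ⊆ t := by
    intro e
    rw [hγdef, Finset.mem_filter, Set.Finite.mem_toFinset]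
  refine ⟨γ, ⟨?_, ?_, ?_⟩, fun e => by rw [hγ, hmemT]⟩
  · have hne : T.Nonempty := by
      obtain ⟨c, hc⟩ := exists_fills_of_isHole hK hR
      obtain ⟨t, ht⟩ := c.exists_triangle
      exact ⟨t.1, t.2.1, t.2.2, hc t ht⟩
    obtain ⟨e, he⟩ := exists_boundary_edge hK.finite_faces hTT hne
    exact ⟨e, (hγ e).2 he⟩
  · intro e he
    obtain ⟨heK, h2, t, ⟨ht, het⟩, huniq⟩ := (hγ e).1 he
    refine ⟨?_, h2⟩
    -- If the edge were missing from the complex, the node across it would lie in `R` too. This node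
    -- is neither the external region, as `R` is bounded, nor a second triangle, as `e` has `R` on
    -- one side only.
    by_contra hα
    obtain ⟨w, hne, hw⟩ := exists_other_side h2 ht.1 ht.2.1 het
    have hl : Link K (alphaComplex C K α) (some ⟨t, ht.1, ht.2.1⟩) w :=
      ⟨e, hα, ⟨h2, het⟩, hw⟩
    obtain ⟨⟨x, hx, rfl⟩, hb⟩ := hR
    have hwR := (region_subset_iff_of_link hK hl x).1 ht.2.2
    rcases w with _ | t'
    · exact not_isBounded_of_external_subset hK.finite_faces hwR hb
    · exact hne (congrArg some (Subtype.ext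
        (huniq t'.1 ⟨⟨t'.2.1, t'.2.2, hwR⟩, hw.2⟩)))
  · refine even_boundary_edges (T := hTfin.toFinset) (fun t ht => hTT t (hTfin.mem_toFinset.1 ht))
      fun e => ?_
    simp only [hTfin.mem_toFinset]
    rw [hγ]
    refine ⟨fun h => h.2, fun h => ⟨?_, h⟩⟩
    obtain ⟨t, ⟨ht, het⟩, -⟩ := h.2
    exact K.down_closed ht.1 het (edge_nonempty h.1)

theorem Bounds.eq {γ γ' : Finset (Finset Plane)} {R : Set Plane} (h : Bounds K γ R)
    (h' : Bounds K γ' R) : γ = γ' :=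
  Finset.ext fun e => (h e).trans (h' e).symm

/-- A hole is determined by its boundary. -/
theorem Bounds.hole_unique (hK : IsDelaunay C K) {γ : Finset (Finset Plane)} {R R' : Set Plane}
    (hR : IsHole (alphaComplex C K α) R) (hR' : IsHole (alphaComplex C K α) R')
    (h : Bounds K γ R) (h' : Bounds K γ R') : R = R' := by
  by_contra hne
  have hdisj : ∀ t : Finset Plane, t ∈ K.faces → t.card = 3 → openTriangle t ⊆ R →
      openTriangle t ⊆ R' → False := by
    intro t ht hcard h1 h2
    obtain ⟨y, hy⟩ := openTriangle_nonempty ht hcard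
    exact hne (hR.eq hR' (h1 hy) (h2 hy))
  -- The triangles of both holes together have a boundary edge, which lies in just one of them. This
  -- edge is in the common boundary, so it would need a triangle from each hole.
  set T : Set (Finset Plane) :=
    {t | t ∈ K.faces ∧ t.card = 3 ∧ (openTriangle t ⊆ R ∨ openTriangle t ⊆ R')} with hT
  have hTne : T.Nonempty := by
    obtain ⟨c, hc⟩ := exists_fills_of_isHole hK hR
    obtain ⟨t, ht⟩ := c.exists_triangle
    exact ⟨t.1, t.2.1, t.2.2, Or.inl (hc t ht)⟩
  obtain ⟨e, heK, he, t, ⟨⟨ht, hcard, hor⟩, het⟩, huniq⟩ :=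
    exists_boundary_edge hK.finite_faces (T := T) (fun t ht => ⟨ht.1, ht.2.1⟩) hTne
  rcases hor with hsub | hsub
  · have heγ : e ∈ γ := (h e).2 ⟨heK, he, t, ⟨ht, hcard, het, hsub⟩,
      fun s hs => huniq s ⟨⟨hs.1, hs.2.1, Or.inl hs.2.2.2⟩, hs.2.2.1⟩⟩
    obtain ⟨-, -, t', ⟨ht', hcard', het', hsub'⟩, -⟩ := (h' e).1 heγ
    obtain rfl := huniq t' ⟨⟨ht', hcard', Or.inr hsub'⟩, het'⟩
    exact hdisj t' ht hcard hsub hsub'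
  · have heγ : e ∈ γ := (h' e).2 ⟨heK, he, t, ⟨ht, hcard, het, hsub⟩,
      fun s hs => huniq s ⟨⟨hs.1, hs.2.1, Or.inr hs.2.2.2⟩, hs.2.2.1⟩⟩
    obtain ⟨-, -, t', ⟨ht', hcard', het', hsub'⟩, -⟩ := (h e).1 heγ
    obtain rfl := huniq t' ⟨⟨ht', hcard', Or.inl hsub'⟩, het'⟩
    exact hdisj t' ht hcard hsub' hsub

/-! ### The bijection and its compatibility with evolution. -/

/-- The contour `γ` bounds the hole that contains the white component `c`. -/
def Encloses (γ : Contour C K α) (c : WhiteComponent K α) : Prop :=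
  ∃ R, IsHole (alphaComplex C K α) R ∧ Bounds K γ.1 R ∧ Fills c R

theorem exists_equiv_encloses (hK : IsDelaunay C K) (α : ℝ≥0) :
    ∃ Φ : Contour C K α ≃ WhiteComponent K α, ∀ γ, Encloses γ (Φ γ) := by
  have h1 : ∀ γ : Contour C K α, ∃ c, Encloses γ c := by
    intro γ
    obtain ⟨R, hR, hb⟩ := γ.2.2
    obtain ⟨c, hc⟩ := exists_fills_of_isHole hK hR
    exact ⟨c, R, hR, hb, hc⟩
  choose f hf using h1
  refine ⟨Equiv.ofBijective f ⟨fun γ γ' h => ?_, fun c => ?_⟩, hf⟩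
  · obtain ⟨R, hR, hb, hc⟩ := hf γ
    obtain ⟨R', hR', hb', hc'⟩ := hf γ'
    rw [h] at hc
    obtain rfl := Fills.hole_unique hR hR' hc hc'
    exact Subtype.ext (hb.eq hb')
  · obtain ⟨R, hR, hc⟩ := exists_isHole_of_white hK c
    obtain ⟨γ, hγ, hb⟩ := exists_contour_of_isHole hK hR
    refine ⟨⟨γ, hγ, R, hR, hb⟩, ?_⟩
    obtain ⟨R', hR', hb', hc'⟩ := hf ⟨γ, hγ, R, hR, hb⟩
    obtain rfl := Bounds.hole_unique hK hR hR' hb hb'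
    exact Fills.unique hK hR hc' hc

/-- Graph vertices persist as the scale decreases, so those in `R ⊆ R'` are in the component of
`R'`. Conversely, `R` is a connected part of the larger complement at scale `β`, and a common
triangle makes it meet `R'`. -/
theorem evolvesTo_iff (hK : IsDelaunay C K) {α β : ℝ≥0} (hβα : β ≤ α) {γ : Contour C K α}
    {γ' : Contour C K β} {c : WhiteComponent K α} {c' : WhiteComponent K β}
    (h : Encloses γ c) (h' : Encloses γ' c') :
    Contour.EvolvesTo C K α β γ γ' ↔ WhiteComponent.EvolvesTo K α β c c' := by
  obtain ⟨R, hR, hb, hc⟩ := h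
  obtain ⟨R', hR', hb', hc'⟩ := h'
  constructor
  · rintro ⟨Q, Q', hQ, hbQ, hQ', hbQ', hsub⟩
    obtain rfl := Bounds.hole_unique hK hR hQ hb hbQ
    obtain rfl := Bounds.hole_unique hK hR' hQ' hb' hbQ'
    intro v hv
    rcases v with _ | t
    · exact absurd hv c.none_not_mem_nodes
    · obtain ⟨hvert, -⟩ := WhiteComponent.mem_nodes_iff.1 hv
      exact hc'.mem_nodes hK hR' (mem_verts_mono hβα hvert) ((hc t hv).trans hsub)
  · intro hsub
    refine ⟨R, R', hR, hb, hR', hb', ?_⟩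
    obtain ⟨t, ht⟩ := c.exists_triangle
    obtain ⟨y, hy⟩ := openTriangle_nonempty t.2.1 t.2.2
    have hyR := hc t ht hy
    have hyR' := hc' t (hsub ht) hy
    obtain ⟨⟨x, hx, rfl⟩, -⟩ := hR
    obtain ⟨⟨x', hx', rfl⟩, -⟩ := hR'
    rw [connectedComponentIn_eq hyR']
    exact isPreconnected_connectedComponentIn.subset_connectedComponentIn hyR
      ((connectedComponentIn_subset _ _).trans
        (compl_subset_compl.2 (space_mono (alphaComplex_mono C K hβα))))

end Holes

/-! ### Transport of births, mergers and deaths along an isomorphism of evolutions -/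

section Transport

variable {X Y : ℝ≥0 → Type} {ev : ∀ α β : ℝ≥0, X α → X β → Prop}
  {ev' : ∀ α β : ℝ≥0, Y α → Y β → Prop} {Φ : ∀ α, X α ≃ Y α}

/-- It suffices to know that the evolutions agree for `β ≤ α`, since the set of scales in a birth
only has `r` with `α ≤ r`; a merger likewise has `r ≤ α`. -/
theorem bornAt_transport
    (hΦ : ∀ α β, β ≤ α → ∀ x y, ev α β x y ↔ ev' α β (Φ α x) (Φ β y)) {α : ℝ≥0} (x : X α)
    (s : ℝ≥0) : BornAt X ev x s ↔ BornAt Y ev' (Φ α x) s := by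
  unfold BornAt
  have : {r : ℝ≥0 | α ≤ r ∧ ∃ x' : X r, ev r α x' x} =
      {r : ℝ≥0 | α ≤ r ∧ ∃ x' : Y r, ev' r α x' (Φ α x)} := by
    ext r
    refine and_congr_right fun hr => ?_
    rw [← (Φ r).exists_congr_right]
    exact exists_congr fun x' => hΦ r α hr x' x
  rw [this]

theorem absorbed_transport
    (hΦ : ∀ α β, β ≤ α → ∀ x y, ev α β x y ↔ ev' α β (Φ α x) (Φ β y)) {α r : ℝ≥0} (hr : r ≤ α)
    (x : X α) : Absorbed X ev x r ↔ Absorbed Y ev' (Φ α x) r := by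
  unfold Absorbed
  rw [← (Φ r).exists_congr_right]
  exact not_congr (exists_congr fun y => hΦ α r hr x y)

theorem mergeAt_transport
    (hΦ : ∀ α β, β ≤ α → ∀ x y, ev α β x y ↔ ev' α β (Φ α x) (Φ β y)) {α : ℝ≥0} (x x' : X α)
    (t : ℝ≥0) : MergeAt X ev x x' t ↔ MergeAt Y ev' (Φ α x) (Φ α x') t := by
  unfold MergeAt
  have : {r : ℝ≥0 | r ≤ α ∧ ((∃ y : X r, ev α r x y ∧ ev α r x' y) ∨
      (Absorbed X ev x r ∧ Absorbed X ev x' r))} =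
      {r : ℝ≥0 | r ≤ α ∧ ((∃ y : Y r, ev' α r (Φ α x) y ∧ ev' α r (Φ α x') y) ∨
      (Absorbed Y ev' (Φ α x) r ∧ Absorbed Y ev' (Φ α x') r))} := by
    ext r
    refine and_congr_right fun hr => or_congr ?_ (and_congr (absorbed_transport hΦ hr x)
      (absorbed_transport hΦ hr x'))
    rw [← (Φ r).exists_congr_right]
    exact exists_congr fun y => and_congr (hΦ α r hr x y) (hΦ α r hr x' y)
  rw [this]

theorem isElderLabelling_transport
    (hΦ : ∀ α β, β ≤ α → ∀ x y, ev α β x y ↔ ev' α β (Φ α x) (Φ β y)) {L : Type}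
    {lab : ∀ α, X α → L} {lab' : ∀ α, Y α → L} (hlab : ∀ α x, lab' α (Φ α x) = lab α x)
    (h : IsElderLabelling X ev lab) : IsElderLabelling Y ev' lab' where
  injective α y₁ y₂ hy := by
    obtain ⟨x₁, rfl⟩ := (Φ α).surjective y₁
    obtain ⟨x₂, rfl⟩ := (Φ α).surjective y₂
    rw [hlab, hlab] at hy
    rw [h.injective α hy]
  elder α β hβα y hy := by
    obtain ⟨y, rfl⟩ := (Φ β).surjective y
    obtain ⟨x, hx⟩ := hy
    obtain ⟨x, rfl⟩ := (Φ α).surjective x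
    obtain ⟨z, hz1, hz2, hz3⟩ := h.elder α β hβα y ⟨x, (hΦ α β hβα x y).2 hx⟩
    refine ⟨Φ α z, (hΦ α β hβα z y).1 hz1, by rw [hlab, hlab, hz2], fun x' hx' s s' hs hs' => ?_⟩
    obtain ⟨x', rfl⟩ := (Φ α).surjective x'
    exact hz3 x' ((hΦ α β hβα x' y).2 hx') s s' ((bornAt_transport hΦ z s).2 hs)
      ((bornAt_transport hΦ x' s').2 hs')
  fresh α β hβα x y hxy := by
    obtain ⟨x, rfl⟩ := (Φ α).surjective x
    obtain ⟨y, rfl⟩ := (Φ β).surjective y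
    rw [hlab, hlab] at hxy
    exact (hΦ α β hβα x y).1 (h.fresh α β hβα x y hxy)

theorem diesAt_transport {L : Type} {lab : ∀ α, X α → L} {lab' : ∀ α, Y α → L}
    (hlab : ∀ α x, lab' α (Φ α x) = lab α x) {α : ℝ≥0} (x : X α) (t : ℝ≥0) :
    DiesAt X lab x t ↔ DiesAt Y lab' (Φ α x) t := by
  unfold DiesAt
  have : {r : ℝ≥0 | ∃ y : X r, lab r y = lab α x} =
      {r : ℝ≥0 | ∃ y : Y r, lab' r y = lab' α (Φ α x)} := by
    ext r
    simp only [Set.mem_ofPred_eq]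
    rw [← (Φ r).exists_congr_right]
    simp only [hlab]
  rw [this]

end Transport

end AlphaDuality

end

/-! ### The duality theorem. -/

open AlphaDuality in
theorem mainTheorem3 (C : Finset Plane) (K : Geometry.SimplicialComplex ℝ Plane)
    (hK : IsDelaunay C K) :
    ∃ Φ : ∀ α : ℝ≥0, Contour C K α ≃ WhiteComponent K α,
      -- a contour encloses the white component that corresponds to it
      (∀ (α : ℝ≥0) (γ : Contour C K α) (R : Set Plane),
        IsHole (alphaComplex C K α) R → Bounds K γ.1 R →
          ∀ t, some t ∈ (Φ α γ).nodes → openTriangle t.1 ⊆ R) ∧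
      -- the correspondence respects the evolution under decreasing scale
      (∀ (α β : ℝ≥0), β ≤ α → ∀ (γ : Contour C K α) (γ' : Contour C K β),
        Contour.EvolvesTo C K α β γ γ' ↔
          WhiteComponent.EvolvesTo K α β (Φ α γ) (Φ β γ')) ∧
      -- births of contours are births of white components
      (∀ (α : ℝ≥0) (γ : Contour C K α) (s : ℝ≥0),
        BornAt (Contour C K) (Contour.EvolvesTo C K) γ s ↔
          BornAt (WhiteComponent K) (WhiteComponent.EvolvesTo K) (Φ α γ) s) ∧
      -- mergers of contours are mergers of white components
      (∀ (α : ℝ≥0) (γ γ' : Contour C K α) (t : ℝ≥0),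
        MergeAt (Contour C K) (Contour.EvolvesTo C K) γ γ' t ↔
          MergeAt (WhiteComponent K) (WhiteComponent.EvolvesTo K) (Φ α γ) (Φ α γ') t) ∧
      -- deaths of contours by the elder rule are deaths of white components by the elder rule
      (∀ (L : Type) (lab : ∀ α : ℝ≥0, Contour C K α → L)
          (lab' : ∀ α : ℝ≥0, WhiteComponent K α → L),
        (∀ (α : ℝ≥0) (γ : Contour C K α), lab' α (Φ α γ) = lab α γ) →
          (IsElderLabelling (Contour C K) (Contour.EvolvesTo C K) lab ↔
            IsElderLabelling (WhiteComponent K) (WhiteComponent.EvolvesTo K) lab') ∧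
          ∀ (α : ℝ≥0) (γ : Contour C K α) (t : ℝ≥0),
            DiesAt (Contour C K) lab γ t ↔ DiesAt (WhiteComponent K) lab' (Φ α γ) t) := by
  choose Φ hΦ using exists_equiv_encloses hK
  have hev : ∀ α β : ℝ≥0, β ≤ α → ∀ (γ : Contour C K α) (γ' : Contour C K β),
      Contour.EvolvesTo C K α β γ γ' ↔ WhiteComponent.EvolvesTo K α β (Φ α γ) (Φ β γ') :=
    fun α β h γ γ' => evolvesTo_iff hK h (hΦ α γ) (hΦ β γ')
  refine ⟨Φ, ?_, hev, fun α γ s => bornAt_transport hev γ s,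
    fun α γ γ' t => mergeAt_transport hev γ γ' t, fun L lab lab' hlab => ⟨⟨?_, ?_⟩, ?_⟩⟩
  · intro α γ R hR hb
    obtain ⟨R', hR', hb', hc⟩ := hΦ α γ
    obtain rfl := Bounds.hole_unique hK hR hR' hb hb'
    exact hc
  · exact isElderLabelling_transport hev hlab
  -- The converse is the same transport along the inverse bijections.
  · refine isElderLabelling_transport (Φ := fun α => (Φ α).symm) (fun α β h x y => ?_)
      (fun α x => ?_)
    · simpa using (hev α β h ((Φ α).symm x) ((Φ β).symm y)).symm
    · simpa using (hlab α ((Φ α).symm x)).symm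
  · exact fun α γ t => diesAt_transport hlab γ t
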